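/- Let $\mathcal X$ be a (second countable) Riemannian manifold of dimension $d$ with Riemannian distance $\mathrm{dist}$, let $\mathrm{Leb}$ be the measure of a volume form on $\mathcal X$ (a Borel measure with continuous, strictly positive density in charts), let $f:\mathcal X\to\mathcal X$ be measurable and let $\mu\ll\mathrm{Leb}$ be an $f$-invariant Borel probability measure. Write $B_\delta(\zeta)=\{x:\mathrm{dist}(x,\zeta)<\delta\}$. Let $\zeta$ be an interior point of $\mathcal X$ (no condition if $\mathcal X$ has no boundary) that is a repelling periodic point of prime period $p\ge1$: $f^p$ is differentiable at $\zeta$ with invertible derivative, $D(f^{-p})(\zeta):=(Df^p(\zeta))^{-1}$ satisfies $0<|\det D(f^{-p})(\zeta)|<1$, and $D(f^{-p})(\zeta)^k v\to0$ as $k\to\infty$ for every tangent vector $v$ (equivalently, all eigenvalues of $Df^p(\zeta)$ have modulus greater than $1$; for $d=1$ this follows from the determinant condition). Put $\theta=1-|\det D(f^{-p})(\zeta)|\in(0,1)$. Assume that $\zeta$ is a Lebesgue point of $\frac{d\mu}{d\mathrm{Leb}}$ with value $\rho\in(0,\infty)$, i.e. $\frac1{\mathrm{Leb}(B_\delta(\zeta))}\int_{B_\delta(\zeta)}\bigl|\frac{d\mu}{d\mathrm{Leb}}-\rho\bigr|\,d\mathrm{Leb}\to0$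 as $\delta\to0^+$. Let $X_i=\varphi\circ f^i$, $i\ge0$, where $\varphi(x)=g(\mathrm{dist}(x,\zeta))$ and $g:[0,\infty)\to\mathbb R\cup\{\pm\infty\}$ has its maximum at $0$ and, for some $\varepsilon>0$ and $w<g(0)$, is a strictly decreasing bijection from $[0,\varepsilon)$ onto $(w,g(0)]$ with $g\le w$ on $[\varepsilon,\infty)$. For $i,s,\ell\ge0$ and $u\in\mathbb R$ put $Q_{p,i}(u)=\{X_i>u,\ X_{i+p}\le u\}$ and $\mathscr Q_{p,s,\ell}(u)=\bigcap_{i=s}^{s+\ell-1}Q_{p,i}(u)^c$. Let $(u_n)$ be real levels with $n\mu(X_0>u_n)\to\tau$ for some $\tau>0$, and assume: * $D^p(u_n)$: there are $\gamma(n,t)$, nonincreasing in $t$, and a sequence of nonnegative integers $t_n=o(n)$ with $n\gamma(n,t_n)\to0$ such that for all nonnegative integers $\ell,t,n$ $$\bigl|\mu(Q_{p,0}(u_n)\cap\mathscr Q_{p,t,\ell}(u_n))-\mu(Q_{p,0}(u_n))\,\mu(\mathscr Q_{p,0,\ell}(u_n))\bigr|\le\gamma(n,t);$$ * $D'_p(u_n)$: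 there are integers $k_n\to\infty$ with $k_nt_n=o(n)$, for this sequence $t_n$, such that $n\sum_{j=1}^{\lfloor n/k_n\rfloor}\mu(Q_{p,0}(u_n)\cap Q_{p,j}(u_n))\to0$. For a Borel set $A$ let $r_A(x)=\min\{j\ge1:f^j(x)\in A\}$ ($=\infty$ if there is no such $j$) and, if $\mu(A)>0$, $\mu_A=\mu(\,\cdot\cap A)/\mu(A)$. Then for every sequence $\delta_n>0$ with $\delta_n\to0$ we have $\mu(B_{\delta_n}(\zeta))\to0$, $$\lim_{n\to\infty}\mu\Bigl(r_{B_{\delta_n}(\zeta)}<\frac t{\mu(B_{\delta_n}(\zeta))}\Bigr)=1-e^{-\theta t}\quad\text{for all }t\ge0,$$ $$\lim_{n\to\infty}\mu_{B_{\delta_n}(\zeta)}\Bigl(r_{B_{\delta_n}(\zeta)}<\frac t{\mu(B_{\delta_n}(\zeta))}\Bigr)=(1-\theta)+\theta\bigl(1-e^{-\theta t}\bigr)\quad\text{for all }t>0,$$ and the same limits hold with $\le$ in place of $<$. -/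

import Mathlib

open MeasureTheory Filter Topology Set Manifold
open scoped ENNReal Asymptotics ContDiff Bundle

noncomputable section

namespace HittingTimes

/-! ### Hitting and return times -/

/-- First hitting time `r_A(x) = min {j ≥ 1 : f^j(x) ∈ A}`, with value `⊤` if there is no such
`j`. -/
def hittingTime {M : Type*} (f : M → M) (A : Set M) (x : M) : ℕ∞ :=
  ⨅ j : {j : ℕ // 1 ≤ j ∧ f^[j] x ∈ A}, ((j : ℕ) : ℕ∞)

/-- The event `r_A ≤ t / μ(A)`. -/
def hitLE {M : Type*} [MeasurableSpace M] (μ : Measure M) (f : M → M) (A : Set M) (t : ℝ) :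
    Set M :=
  {x | ((hittingTime f A x : ℕ∞) : ℝ≥0∞) ≤ ENNReal.ofReal t / μ A}

/-- The event `r_A < t / μ(A)`. -/
def hitLT {M : Type*} [MeasurableSpace M] (μ : Measure M) (f : M → M) (A : Set M) (t : ℝ) :
    Set M :=
  {x | ((hittingTime f A x : ℕ∞) : ℝ≥0∞) < ENNReal.ofReal t / μ A}

/-- Hitting time statistics `G` for the sets `U n`. -/
def HasHTS {M : Type*} [MeasurableSpace M] (μ : Measure M) (f : M → M) (U : ℕ → Set M)
    (G : ℝ → ℝ) : Prop :=
  Tendsto (fun n => μ (U n)) atTop (𝓝 0) ∧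
    ∀ t : ℝ, 0 ≤ t → Tendsto (fun n => μ.real (hitLE μ f (U n) t)) atTop (𝓝 (G t))

/-- Return time statistics `G` for the sets `U n`: the starting point is distributed according to
the conditional measure on `U n`. Since `r ≥ 1`, the law of `r` never charges `t = 0`, whereas the
limit may have an atom there; the convergence is at all `t > 0`. -/
def HasRTS {M : Type*} [MeasurableSpace M] (μ : Measure M) (f : M → M) (U : ℕ → Set M)
    (G : ℝ → ℝ) : Prop :=
  Tendsto (fun n => μ (U n)) atTop (𝓝 0) ∧
    ∀ t : ℝ, 0 < t → Tendsto
      (fun n => (ProbabilityTheory.cond μ (U n)).real (hitLE μ f (U n) t)) atTop (𝓝 (G t))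

/-! ### Escapes and the mixing conditions for a process `X 0, X 1, …` -/

/-- The escape `{X_i > u, X_{i+p} ≤ u}` at time `i`. -/
def escape {M : Type*} (X : ℕ → M → EReal) (p i : ℕ) (u : ℝ) : Set M :=
  {x | (u : EReal) < X i x ∧ X (i + p) x ≤ (u : EReal)}

/-- No escape at the times `s, …, s + ℓ - 1`. -/
def noEscape {M : Type*} (X : ℕ → M → EReal) (p s ℓ : ℕ) (u : ℝ) : Set M :=
  ⋂ i ∈ Finset.Ico s (s + ℓ), (escape X p i u)ᶜ

/-- Condition `D^p(u_n)`, with `T n` the sequence of gaps occurring in it. -/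
def CondDp {M : Type*} [MeasurableSpace M] (μ : Measure M) (X : ℕ → M → EReal) (p : ℕ)
    (u : ℕ → ℝ) (T : ℕ → ℕ) : Prop :=
  (fun n => (T n : ℝ)) =o[atTop] (fun n : ℕ => (n : ℝ)) ∧
  ∃ γ : ℕ → ℕ → ℝ, (∀ n, Antitone (γ n)) ∧
    Tendsto (fun n : ℕ => (n : ℝ) * γ n (T n)) atTop (𝓝 0) ∧
    ∀ n t ℓ : ℕ,
      |μ.real (escape X p 0 (u n) ∩ noEscape X p t ℓ (u n))
        - μ.real (escape X p 0 (u n)) * μ.real (noEscape X p 0 ℓ (u n))| ≤ γ n t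

/-- Condition `D'_p(u_n)`, relative to the gap sequence `T n` of `D^p(u_n)`. -/
def CondDp' {M : Type*} [MeasurableSpace M] (μ : Measure M) (X : ℕ → M → EReal) (p : ℕ)
    (u : ℕ → ℝ) (T : ℕ → ℕ) : Prop :=
  ∃ k : ℕ → ℕ, Tendsto k atTop atTop ∧
    (fun n => (k n : ℝ) * (T n : ℝ)) =o[atTop] (fun n : ℕ => (n : ℝ)) ∧
    Tendsto (fun n : ℕ => (n : ℝ) * ∑ j ∈ Finset.Icc 1 (n / k n),
      μ.real (escape X p 0 (u n) ∩ escape X p j (u n))) atTop (𝓝 0)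

/-! ### Observables -/

/-- The profile `g` of the observable `x ↦ g (dist x ζ)`, a function on `[0, ∞)`: on some
`V = [0, ε)` it is a strictly decreasing bijection onto a one-sided neighbourhood `W = (w, g 0]`
of its maximum, and outside `V` it stays below `W`, so that the sets `{φ > u}` with `u` close to
`g 0` are balls centred at `ζ`. The value `g 0` may be `+∞`. -/
def IsPeak (g : ℝ → EReal) : Prop :=
  ∃ ε > 0, ∃ w < g 0, StrictAntiOn g (Ico 0 ε) ∧ BijOn g (Ico 0 ε) (Ioc w (g 0)) ∧
    ∀ r, ε ≤ r → g r ≤ w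

/-- The process `X_i = φ ∘ f^i` with `φ x = g (dist x ζ)`. -/
def process {M : Type*} [Dist M] (f : M → M) (ζ : M) (g : ℝ → EReal) : ℕ → M → EReal :=
  fun i x => g (dist (f^[i] x) ζ)

/-! ### Lebesgue measure on a manifold, density points, repelling periodic points -/

section Manifold

variable {d : ℕ} {H : Type*} [TopologicalSpace H]
  (I : ModelWithCorners ℝ (EuclideanSpace ℝ (Fin d)) H)
  {M : Type*}

/-- `Leb` is the measure of a volume form: in each chart it has a continuous, strictly positive
density with respect to the Lebesgue measure of `ℝ^d`. -/
def IsVolumeMeasure [TopologicalSpace M] [ChartedSpace H M] [MeasurableSpace M]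
    (Leb : Measure M) : Prop :=
  ∀ x : M, ∃ h : EuclideanSpace ℝ (Fin d) → ℝ,
    ContinuousOn h (extChartAt I x).target ∧ (∀ y ∈ (extChartAt I x).target, 0 < h y) ∧
    ∀ s ⊆ (extChartAt I x).source, MeasurableSet s →
      Leb s = ∫⁻ y in extChartAt I x '' s, ENNReal.ofReal (h y) ∂volume

/-- `ζ` is a Lebesgue point of the density `dμ/dLeb`, where the density has the value `ρ`. -/
def IsLebesguePoint [PseudoMetricSpace M] [MeasurableSpace M] (μ Leb : Measure M) (ζ : M)
    (ρ : ℝ) : Prop :=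
  Tendsto (fun δ : ℝ => (∫⁻ x in Metric.ball ζ δ, ‖(μ.rnDeriv Leb x).toReal - ρ‖ₑ ∂Leb)
    / Leb (Metric.ball ζ δ)) (𝓝[>] 0) (𝓝 0)

/-- `ζ` is a repelling periodic point of prime period `p`, `L` being the (invertible) derivative of
`f^p` at `ζ`, so that `L.symm` is `D(f^{-p})(ζ)`: the determinant of `L.symm` has absolute value
less than `1`, and `L.symm` contracts in the sense that its iterates tend to `0` (all eigenvalues
of `L` lie outside the closed unit disc; for `d = 1` this is the determinant condition again). -/
structure IsRepellingPeriodicPoint [TopologicalSpace M] [ChartedSpace H M]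
    (f : M → M) (p : ℕ) (ζ : M) (L : TangentSpace I ζ ≃L[ℝ] TangentSpace I ζ) : Prop where
  period_pos : 0 < p
  minimalPeriod_eq : Function.minimalPeriod f ζ = p
  hasMFDerivAt : HasMFDerivAt I I f^[p] ζ
    (L : TangentSpace I ζ →L[ℝ] TangentSpace I ζ)
  abs_det_lt : |(L.symm : TangentSpace I ζ →L[ℝ] TangentSpace I ζ).det| < 1
  contracting : ∀ v : TangentSpace I ζ, Tendsto (fun k : ℕ => L.symm^[k] v) atTop (𝓝 0)

end Manifold

end HittingTimes

end

/-! Let `B` be a small ball at `ζ` and `Q = B \ f⁻ᵖ B` its escape set. An orbit that visits `B`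
before time `N` and never escapes keeps visiting `B` every `p` steps until it passes `N`. Avoiding
`B` and avoiding `Q` up to time `N` therefore differ in probability by at most `p * μ B`
(`abs_measureReal_avoid_sub_avoid_escape_le`). Unlike visits to `B`, escapes do not cluster, so a
block argument gives them an exponential law (`tendsto_measureReal_avoid_exp`). Its rate is governed
by the extremal index, the limit of `μ Q / μ B`, and the analytic task is to show that this limit is
`θ`.

Magnify the chart at `ζ` by `1 / r`. As `r → 0` the ball becomes the unit ball `U` of the Riemannian
norm at `ζ`, `μ` becomes a multiple of Lebesgue measure, and `f^p` becomes its derivative `L`. Hence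
`μ Q / μ B` tends to `κ = 1 - |U ∩ L⁻¹U| / |U|`. Since `|L⁻¹U| = |det L⁻¹| |U|`, always `κ ≥ θ`,
with equality exactly when `L⁻¹U ⊆ U` up to a null set. The spectrum of `L` alone does not give this
inclusion: `L⁻¹` may stretch some vectors before it contracts them.

The inclusion comes from `D'_p`. It makes two escapes at a fixed distance in time negligible, so
almost no orbit of `L` leaves `U` twice. The backward orbit of a point of `L⁻¹U \ U` enters `U`, and
its forward orbit almost surely leaves `U` after having come back. Such a point therefore lies on an
orbit leaving `U` twice, and these points form a null set (`addHaar_inter_preimage_of_repelling`,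
`exists_tendsto_escape_div`). For a fixed lag to occur in the sum of `D'_p` one needs `k_n = o(n)`.
This holds because `D^p` forces the gaps to be eventually nonzero: with gap `0` it would compare
`μ(Q ∩ Qᶜ) = 0` with `μ Q (1 - μ Q)` (`tendsto_nat_mul_measureReal_escape`).

Arbitrary radii are reached by comparing concentric balls of asymptotically equal measure
(`tendsto_measureReal_avoid_ball`). Return times follow from hitting times because, by invariance,
the return law is the discrete derivative of the hitting law (`tendsto_inter_avoid_div`). -/

noncomputable section

namespace HittingTimes

/-! ### Riemannian distance to first order in a chart -/

section Riemannian

variable {E : Type*} [NormedAddCommGroup E] [NormedSpace ℝ E] {H : Type*} [TopologicalSpace H]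
  (I : ModelWithCorners ℝ E H) {M : Type*} [MetricSpace M] [ChartedSpace H M] [IsManifold I 1 M]
  [Bundle.RiemannianBundle (fun x : M => TangentSpace I x)]

/-- The Riemannian norm at the point `x`, of a vector read in the preferred chart at `x`. -/
def chartNorm (x : M) (v : E) : ℝ :=
  ‖(trivializationAt E (TangentSpace I) x).symmL ℝ x v‖

lemma chartNorm_nonneg (x : M) (v : E) : 0 ≤ chartNorm I x v := norm_nonneg _

lemma chartNorm_add_le (x : M) (v w : E) :
    chartNorm I x (v + w) ≤ chartNorm I x v + chartNorm I x w := by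
  unfold chartNorm
  rw [map_add]
  exact norm_add_le _ _

lemma chartNorm_smul (x : M) (c : ℝ) (v : E) :
    chartNorm I x (c • v) = |c| * chartNorm I x v := by
  unfold chartNorm
  rw [map_smul, norm_smul, Real.norm_eq_abs]

lemma continuous_chartNorm (x : M) : Continuous (chartNorm I x : E → ℝ) :=
  ((trivializationAt E (TangentSpace I) x).symmL ℝ x).continuous.norm

/-- The trivialization at `x` has a continuous inverse on the fibre. This is what bounds the unit
ball of `chartNorm`, and so makes its volume finite. -/
lemma exists_norm_le_chartNorm (x : M) :
    ∃ C > 0, ∀ v : E, ‖v‖ ≤ C * chartNorm I x v := by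
  have hx : x ∈ (trivializationAt E (TangentSpace I) x).baseSet :=
    FiberBundle.mem_baseSet_trivializationAt' x
  let G := (trivializationAt E (TangentSpace I) x).continuousLinearMapAt ℝ x
  refine ⟨‖G‖ + 1, by positivity, fun v => ?_⟩
  have h1 : G ((trivializationAt E (TangentSpace I) x).symmL ℝ x v) = v :=
    Bundle.Trivialization.continuousLinearMapAt_symmL _ hx v
  have h2 := G.le_opNorm ((trivializationAt E (TangentSpace I) x).symmL ℝ x v)
  rw [h1] at h2
  have h3 := chartNorm_nonneg I x v
  change ‖v‖ ≤ ‖G‖ * chartNorm I x v at h2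
  linarith

variable [IsContinuousRiemannianBundle E (fun x : M => TangentSpace I x)]

/-- Continuity of the metric: read in the chart at `x`, nearby tangent norms are almost the norm at
`x`. This side bounds lengths from above; the next lemma bounds them from below. -/
lemma eventually_norm_symmL_le_chartNorm (x : M) {r : ℝ} (hr : 1 < r) :
    ∀ᶠ y in 𝓝 x, ∀ v : E,
      ‖(trivializationAt E (TangentSpace I) x).symmL ℝ y v‖ ≤ r * chartNorm I x v := by
  filter_upwards [eventually_norm_symmL_trivializationAt_comp_self_lt E
    (fun x : M => TangentSpace I x) x hr] with y hy v
  have hx : x ∈ (trivializationAt E (TangentSpace I) x).baseSet :=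
    FiberBundle.mem_baseSet_trivializationAt' x
  have h1 := ContinuousLinearMap.le_of_opNorm_le _ hy.le
    ((trivializationAt E (TangentSpace I) x).symmL ℝ x v)
  rw [ContinuousLinearMap.comp_apply,
    Bundle.Trivialization.continuousLinearMapAt_symmL _ hx] at h1
  exact h1

lemma eventually_chartNorm_continuousLinearMapAt_le (x : M) {r : ℝ} (hr : 1 < r) :
    ∀ᶠ y in 𝓝 x, ∀ v : TangentSpace I y,
      chartNorm I x ((trivializationAt E (TangentSpace I) x).continuousLinearMapAt ℝ y v)
        ≤ r * ‖v‖ := by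
  filter_upwards [eventually_norm_symmL_trivializationAt_self_comp_lt E
    (fun x : M => TangentSpace I x) x hr] with y hy v
  exact ContinuousLinearMap.le_of_opNorm_le _ hy.le v

variable [IsRiemannianManifold I M]

/-- The straight segment in the chart is a competitor for the distance. It stays in the chart
because `range I` is convex, and its velocity is constant. -/
lemma eventually_dist_le_chartNorm (x : M) {r : ℝ} (hr : 1 < r) :
    ∀ᶠ y in 𝓝 x, dist x y ≤ r * chartNorm I x (extChartAt I x y - extChartAt I x x) := by
  have hsrc : (chartAt H x).source ∈ 𝓝 x := chart_source_mem_nhds H x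
  have key := (eventually_norm_symmL_le_chartNorm I x hr).and hsrc
  have hcont : Tendsto (extChartAt I x).symm (𝓝 (extChartAt I x x)) (𝓝 x) := by
    have := continuousAt_extChartAt_symm (I := I) x
    rwa [ContinuousAt, extChartAt_to_inv] at this
  have hC := hcont.eventually key
  obtain ⟨ρ, ρ_pos, hρ⟩ := Metric.mem_nhdsWithin_iff.1
    (inter_mem (extChartAt_target_mem_nhdsWithin x) (nhdsWithin_le_nhds hC))
  have A : (extChartAt I x) ⁻¹' (Metric.ball (extChartAt I x x) ρ ∩ range I) ∈ 𝓝 x := by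
    apply extChartAt_preimage_mem_nhds_of_mem_nhdsWithin (by simp)
    rw [inter_comm]
    exact inter_mem_nhdsWithin _ (Metric.ball_mem_nhds _ ρ_pos)
  filter_upwards [A, hsrc] with y hy h'y
  set w : E := extChartAt I x y - extChartAt I x x with hw
  let η : ℝ → E := fun t => extChartAt I x x + t • w
  let γ : ℝ → M := (extChartAt I x).symm ∘ η
  have hη : ∀ t ∈ Icc (0 : ℝ) 1, η t ∈ (extChartAt I x).target ∧
      (∀ v : E, ‖(trivializationAt E (TangentSpace I) x).symmL ℝ (γ t) v‖
        ≤ r * chartNorm I x v) ∧ γ t ∈ (chartAt H x).source := by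
    intro t ht
    have hconv : Convex ℝ (Metric.ball (extChartAt I x x) ρ ∩ range I) :=
      (convex_ball _ _).inter I.convex_range
    have : η t ∈ Metric.ball (extChartAt I x x) ρ ∩ range I :=
      hconv.add_smul_sub_mem (by simp [ρ_pos]) hy ht
    have := hρ this
    exact ⟨this.1, this.2.1, this.2.2⟩
  have hηd : ∀ t, HasDerivAt η w t := fun t => by
    have := ((hasDerivAt_id t).smul_const w).const_add (extChartAt I x x)
    rwa [one_smul] at this
  have η_smooth : ContMDiffOn 𝓘(ℝ, ℝ) 𝓘(ℝ, E) 1 η (Icc 0 1) := by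
    rw [contMDiffOn_iff_contDiffOn]
    fun_prop
  have h1 : riemannianEDist I x y ≤ pathELength I γ 0 1 := by
    apply riemannianEDist_le_pathELength _ _ _ zero_le_one
    · exact (contMDiffOn_extChartAt_symm x).comp η_smooth fun t ht => (hη t ht).1
    · simp [γ, η]
    · simp [γ, η, w, h'y]
  have h2 : pathELength I γ 0 1 ≤ ENNReal.ofReal (r * chartNorm I x w) := by
    rw [pathELength_eq_lintegral_mfderivWithin_Icc]
    calc _ ≤ ∫⁻ _ in Icc (0:ℝ) 1, ENNReal.ofReal (r * chartNorm I x w) := by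
          apply setLIntegral_mono' measurableSet_Icc (fun t ht ↦ ?_)
          have hud : UniqueMDiffWithinAt 𝓘(ℝ, ℝ) (Icc (0:ℝ) 1) t := by
            rw [uniqueMDiffWithinAt_iff_uniqueDiffWithinAt]
            exact uniqueDiffOn_Icc zero_lt_one t ht
          have hs : mfderiv[Icc 0 1] γ t =
              (mfderiv[range I] (extChartAt I x).symm (η t)) ∘L (mfderiv[Icc 0 1] η t) := by
            apply mfderivWithin_comp
            · exact mdifferentiableWithinAt_extChartAt_symm (hη t ht).1
            · exact η_smooth.mdifferentiableOn one_ne_zero t ht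
            · exact fun s hs => extChartAt_target_subset_range x (hη s hs).1
            · exact hud
          have hs' : mfderiv[Icc 0 1] γ t 1 =
              (mfderiv[range I] (extChartAt I x).symm (η t)) (mfderiv[Icc 0 1] η t 1) :=
            congr($hs 1)
          have hηt : (mfderiv[Icc 0 1] η t 1 : E) = w := by
            rw [mfderivWithin_eq_fderivWithin]
            have := ((hηd t).hasDerivWithinAt (s := Icc 0 1)).derivWithin
              (uniqueDiffOn_Icc zero_lt_one t ht)
            exact this
          have hsym := TangentBundle.symmL_trivializationAt (I := I) (hη t ht).2.2
          have hr' : extChartAt I x (γ t) = η t := (extChartAt I x).right_inv (hη t ht).1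
          rw [hr'] at hsym
          have hval : mfderiv[Icc 0 1] γ t 1 =
              (trivializationAt E (TangentSpace I) x).symmL ℝ (γ t) w := by
            rw [hs', hsym]
            exact congrArg (mfderiv[range I] (extChartAt I x).symm (η t)) hηt
          rw [hval, ← ofReal_norm]
          exact ENNReal.ofReal_le_ofReal ((hη t ht).2.1 w)
      _ = _ := by simp
  have h3 := h1.trans h2
  rw [← IsRiemannianManifold.out, edist_dist] at h3
  exact (ENNReal.ofReal_le_ofReal_iff (mul_nonneg (by linarith) (norm_nonneg _))).1 h3

/-- An almost minimal curve, read in the chart with the fixed norm at `x`, has length at least that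
of the chord joining its endpoints. -/
lemma eventually_chartNorm_le_dist (x : M) {r : ℝ} (hr : 1 < r) :
    ∀ᶠ y in 𝓝 x, chartNorm I x (extChartAt I x y - extChartAt I x x) ≤ r * dist x y := by
  have hsrc : (chartAt H x).source ∈ 𝓝 x := chart_source_mem_nhds H x
  obtain ⟨ε, ε_pos, hε⟩ := Metric.eventually_nhds_iff.1
    ((eventually_chartNorm_continuousLinearMapAt_le I x hr).and hsrc)
  filter_upwards [Metric.ball_mem_nhds x ε_pos] with y hy
  -- The infimum of lengths need not be attained, so curves of length less than `c` are used and `c`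
  -- decreases to the distance at the end.
  have hlt : ∀ c, dist x y < c → c ≤ ε →
      chartNorm I x (extChartAt I x y - extChartAt I x x) ≤ r * c := by
    intro c hc hcε
    have hc0 : 0 < c := dist_nonneg.trans_lt hc
    have hR : riemannianEDist I x y < ENNReal.ofReal c := by
      rw [← IsRiemannianManifold.out, edist_dist]
      exact (ENNReal.ofReal_lt_ofReal_iff hc0).2 hc
    obtain ⟨γ, hγx, hγy, γ_smooth, hγ, -⟩ :=
      exists_lt_locally_constant_of_riemannianEDist_lt hR zero_lt_one
    -- Each initial piece is no longer than the whole curve, so the curve cannot leave the good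
    -- neighbourhood.
    have hmem : ∀ t ∈ Icc (0 : ℝ) 1, dist (γ t) x < ε := by
      intro t ht
      have h1 : riemannianEDist I x (γ t) ≤ pathELength I γ 0 t :=
        riemannianEDist_le_pathELength γ_smooth.contMDiffOn hγx rfl ht.1
      have h2 : riemannianEDist I x (γ t) < ENNReal.ofReal c :=
        (h1.trans (pathELength_mono le_rfl ht.2)).trans_lt hγ
      rw [← IsRiemannianManifold.out, edist_dist, ENNReal.ofReal_lt_ofReal_iff hc0] at h2
      rw [dist_comm]
      exact h2.trans_le hcε
    let e : E →L[ℝ] TangentSpace I x := (trivializationAt E (TangentSpace I) x).symmL ℝ x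
    let γ' : ℝ → E := extChartAt I x ∘ γ
    have hγ' : ContMDiffOn 𝓘(ℝ, ℝ) 𝓘(ℝ, E) 1 γ' (Icc 0 1) :=
      contMDiffOn_extChartAt.comp (I' := I) (t := (chartAt H x).source)
        γ_smooth.contMDiffOn (fun t' ht' ↦ (hε (hmem t' ht')).2)
    rw [contMDiffOn_iff_contDiffOn] at hγ'
    have hder : ∀ t ∈ Icc (0 : ℝ) 1, ‖derivWithin (e ∘ γ') (Icc 0 1) t‖ₑ
        ≤ ENNReal.ofReal r * ‖mfderiv[Icc 0 1] γ t 1‖ₑ := by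
      intro t ht
      have hud := uniqueDiffOn_Icc (zero_lt_one (α := ℝ)) t ht
      have h1 : derivWithin (e ∘ γ') (Icc 0 1) t = e (derivWithin γ' (Icc 0 1) t) := by
        have := ((hγ'.differentiableOn one_ne_zero) t ht).hasDerivWithinAt
        exact (e.hasFDerivAt.comp_hasDerivWithinAt t this).derivWithin hud
      have h2 : mfderiv[Icc 0 1] γ' t =
          (mfderiv% (extChartAt I x) (γ t)) ∘L (mfderiv[Icc 0 1] γ t) := by
        apply mfderiv_comp_mfderivWithin
        · exact mdifferentiableAt_extChartAt (hε (hmem t ht)).2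
        · exact (γ_smooth.mdifferentiable one_ne_zero).mdifferentiableOn _ ht
        · rw [uniqueMDiffWithinAt_iff_uniqueDiffWithinAt]
          exact hud
      have h3 : mfderiv[Icc 0 1] γ' t 1 =
          (mfderiv% (extChartAt I x) (γ t)) (mfderiv[Icc 0 1] γ t 1) := congr($h2 1)
      have h4 : (derivWithin γ' (Icc 0 1) t : E) =
          (trivializationAt E (TangentSpace I) x).continuousLinearMapAt ℝ (γ t)
            (mfderiv[Icc 0 1] γ t 1) := by
        rw [TangentBundle.continuousLinearMapAt_trivializationAt (hε (hmem t ht)).2]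
        refine Eq.trans ?_ h3
        rw [mfderivWithin_eq_fderivWithin]
        rfl
      rw [h1, h4, ← ofReal_norm, ← ofReal_norm, ← ENNReal.ofReal_mul (by linarith)]
      exact ENNReal.ofReal_le_ofReal ((hε (hmem t ht)).1 _)
    have hfin : ENNReal.ofReal (chartNorm I x (extChartAt I x y - extChartAt I x x))
        ≤ ENNReal.ofReal (r * c) := by
      calc _ = ‖(e ∘ γ') 1 - (e ∘ γ') 0‖ₑ := by
            rw [← ofReal_norm]
            simp only [Function.comp_apply, γ', hγx, hγy, ← map_sub]
            rfl
        _ ≤ ∫⁻ t in Icc 0 1, ‖derivWithin (e ∘ γ') (Icc 0 1) t‖ₑ :=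
          enorm_sub_le_lintegral_derivWithin_Icc_of_contDiffOn_Icc
            (e.contDiff.comp_contDiffOn hγ') zero_le_one
        _ ≤ ∫⁻ t in Icc (0 : ℝ) 1, ENNReal.ofReal r * ‖mfderiv[Icc 0 1] γ t 1‖ₑ :=
          setLIntegral_mono' measurableSet_Icc hder
        _ = ENNReal.ofReal r * pathELength I γ 0 1 := by
          rw [lintegral_const_mul' _ _ ENNReal.ofReal_ne_top,
            pathELength_eq_lintegral_mfderivWithin_Icc]
        _ ≤ ENNReal.ofReal r * ENNReal.ofReal c := by gcongr
        _ = _ := by rw [← ENNReal.ofReal_mul (by linarith)]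
    exact (ENNReal.ofReal_le_ofReal_iff (by positivity)).1 hfin
  rw [Metric.mem_ball, dist_comm] at hy
  have hlim : Tendsto (fun c => r * c) (𝓝[>] (dist x y)) (𝓝 (r * dist x y)) :=
    (tendsto_const_nhds.mul tendsto_id).mono_left nhdsWithin_le_nhds
  refine ge_of_tendsto hlim ?_
  filter_upwards [Ioo_mem_nhdsGT hy] with c hc using hlt c hc.1 hc.2.le

end Riemannian

/-! ### Blow-up of points and orbits at a fixed point -/

section BlowUp

variable {E : Type*} [NormedAddCommGroup E] [NormedSpace ℝ E] {H : Type*} [TopologicalSpace H]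
  (I : ModelWithCorners ℝ E H) {M : Type*} [MetricSpace M] [ChartedSpace H M]

/-- The point which is represented by `r • v` in the preferred chart at `ζ`, centred at `ζ`. -/
def blowUp (ζ : M) (r : ℝ) (v : E) : M :=
  (extChartAt I ζ).symm (extChartAt I ζ ζ + r • v)

/-- The curve `x` tends to `ζ` with velocity `v` as its parameter decreases to `0`. -/
def HasVelocity (ζ : M) (x : ℝ → M) (v : E) : Prop :=
  Tendsto x (𝓝[>] 0) (𝓝 ζ) ∧
    Tendsto (fun r : ℝ => r⁻¹ • (extChartAt I ζ (x r) - extChartAt I ζ ζ)) (𝓝[>] 0) (𝓝 v)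

variable {I}

lemma tendsto_add_smul_nhdsGT_zero (a v : E) :
    Tendsto (fun r : ℝ => a + r • v) (𝓝[>] 0) (𝓝 a) := by
  have : Continuous fun r : ℝ => a + r • v := by fun_prop
  simpa using (this.tendsto 0).mono_left nhdsWithin_le_nhds

lemma extChartAt_target_mem_nhds_of_isInteriorPoint {ζ : M} (hζ : I.IsInteriorPoint ζ) :
    (extChartAt I ζ).target ∈ 𝓝 (extChartAt I ζ ζ) := by
  have h := extChartAt_target_mem_nhdsWithin (I := I) ζ
  rwa [nhdsWithin_eq_nhds.2 (mem_interior_iff_mem_nhds.1 hζ)] at h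

lemma hasVelocity_blowUp {ζ : M} (hζ : I.IsInteriorPoint ζ) (v : E) :
    HasVelocity I ζ (fun r => blowUp I ζ r v) v := by
  have h0 := tendsto_add_smul_nhdsGT_zero (extChartAt I ζ ζ) v
  constructor
  · have := (continuousAt_extChartAt_symm (I := I) ζ).tendsto
    rw [extChartAt_to_inv] at this
    exact this.comp h0
  · refine tendsto_const_nhds.congr' ?_
    filter_upwards [h0.eventually (extChartAt_target_mem_nhds_of_isInteriorPoint hζ),
      self_mem_nhdsWithin] with r hr hr0
    rw [blowUp, (extChartAt I ζ).right_inv hr, add_sub_cancel_left,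
      inv_smul_smul₀ (ne_of_gt hr0)]

/-- Chain rule for curves known only asymptotically at `ζ`: differentiability of `F` at that single
point suffices. -/
lemma HasVelocity.comp_of_hasFDerivWithinAt {ζ : M} {x : ℝ → M} {v : E}
    (hx : HasVelocity I ζ x v) {F : M → M} {L : E →L[ℝ] E} (hF : F ζ = ζ)
    (hc : ContinuousAt F ζ)
    (hd : HasFDerivWithinAt (extChartAt I ζ ∘ F ∘ (extChartAt I ζ).symm) L (range I)
      (extChartAt I ζ ζ)) :
    HasVelocity I ζ (fun r => F (x r)) (L v) := by
  have hc' : Tendsto F (𝓝 ζ) (𝓝 ζ) := by simpa [ContinuousAt, hF] using hc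
  refine ⟨hc'.comp hx.1, ?_⟩
  have hsrc : ∀ᶠ r in 𝓝[>] (0 : ℝ), x r ∈ (extChartAt I ζ).source :=
    hx.1.eventually (extChartAt_source_mem_nhds (I := I) ζ)
  have h0 : Tendsto (fun r => extChartAt I ζ (x r) - extChartAt I ζ ζ) (𝓝[>] (0 : ℝ)) (𝓝 0) := by
    simpa using ((continuousAt_extChartAt (I := I) ζ).tendsto.comp hx.1).sub_const
      (extChartAt I ζ ζ)
  have hlim := hd.lim h0 (c := fun r => r⁻¹) ?_ hx.2
  · refine hlim.congr' ?_
    filter_upwards [hsrc] with r hr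
    simp only [Function.comp_apply, add_sub_cancel, extChartAt_to_inv, hF,
      (extChartAt I ζ).left_inv hr]
  · filter_upwards [hsrc] with r hr
    rw [add_sub_cancel]
    exact extChartAt_target_subset_range ζ ((extChartAt I ζ).map_source hr)

lemma HasVelocity.iterate {ζ : M} {x : ℝ → M} {v : E}
    (hx : HasVelocity I ζ x v) {F : M → M} {L : E →L[ℝ] E} (hF : F ζ = ζ)
    (hc : ContinuousAt F ζ)
    (hd : HasFDerivWithinAt (extChartAt I ζ ∘ F ∘ (extChartAt I ζ).symm) L (range I)
      (extChartAt I ζ ζ)) (j : ℕ) :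
    HasVelocity I ζ (fun r => F^[j] (x r)) (L^[j] v) := by
  induction j with
  | zero => exact hx
  | succ j ih =>
    simp only [Function.iterate_succ_apply']
    exact ih.comp_of_hasFDerivWithinAt hF hc hd

lemma HasVelocity.tendsto_dist_div [IsManifold I 1 M]
    [Bundle.RiemannianBundle (fun x : M => TangentSpace I x)]
    [IsContinuousRiemannianBundle E (fun x : M => TangentSpace I x)] [IsRiemannianManifold I M]
    {ζ : M} {x : ℝ → M} {v : E} (hx : HasVelocity I ζ x v) :
    Tendsto (fun r => dist (x r) ζ / r) (𝓝[>] 0) (𝓝 (chartNorm I ζ v)) := by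
  set n : ℝ → ℝ := fun r => chartNorm I ζ (r⁻¹ • (extChartAt I ζ (x r) - extChartAt I ζ ζ))
  have hn : Tendsto n (𝓝[>] 0) (𝓝 (chartNorm I ζ v)) :=
    ((continuous_chartNorm I ζ).tendsto v).comp hx.2
  have hn' : ∀ r, 0 < r →
      chartNorm I ζ (extChartAt I ζ (x r) - extChartAt I ζ ζ) = r * n r := by
    intro r hr
    simp only [n, chartNorm_smul, abs_of_pos (inv_pos.2 hr)]
    field_simp
  have bounds : ∀ c : ℝ, 1 < c →
      ∀ᶠ r in 𝓝[>] (0 : ℝ), n r ≤ c * (dist (x r) ζ / r) ∧ dist (x r) ζ / r ≤ c * n r := by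
    intro c hc
    filter_upwards [hx.1.eventually (eventually_chartNorm_le_dist I ζ hc),
      hx.1.eventually (eventually_dist_le_chartNorm I ζ hc), self_mem_nhdsWithin]
      with r h1 h2 hr
    have hr : 0 < r := hr
    rw [hn' r hr, dist_comm] at h1 h2
    constructor
    · rw [← mul_div_assoc, le_div_iff₀ hr]; linarith
    · rw [div_le_iff₀ hr]; linarith
  have hcont : ∀ b : ℝ, Tendsto (fun c : ℝ => c * b) (𝓝[>] 1) (𝓝 b) := fun b => by
    have : Continuous fun c : ℝ => c * b := by fun_prop
    simpa using (this.tendsto 1).mono_left nhdsWithin_le_nhds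
  refine tendsto_order.2 ⟨fun b hb => ?_, fun b hb => ?_⟩
  · obtain ⟨c, hc, hc1⟩ := (((hcont b).eventually_lt_const hb).and self_mem_nhdsWithin).exists
    filter_upwards [bounds c hc1, hn.eventually_const_lt hc] with r hr hr'
    exact lt_of_mul_lt_mul_left (hr'.trans_le hr.1) (zero_le_one.trans (le_of_lt hc1))
  · obtain ⟨c, hc, hc1⟩ := (((hcont _).eventually_lt_const hb).and self_mem_nhdsWithin).exists
    filter_upwards [bounds c hc1, (hn.const_mul c).eventually_lt_const hc] with r hr hr'
    exact hr.2.trans_lt hr'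

/-- The rescaled distance tends to the norm of `v`, which decides membership in the ball unless that
norm is `1`. The excluded velocities form a null set by `ae_chartNorm_ne_one`. -/
lemma HasVelocity.eventually_mem_ball_iff [IsManifold I 1 M]
    [Bundle.RiemannianBundle (fun x : M => TangentSpace I x)]
    [IsContinuousRiemannianBundle E (fun x : M => TangentSpace I x)] [IsRiemannianManifold I M]
    {ζ : M} {x : ℝ → M} {v : E} (hx : HasVelocity I ζ x v) (hv : chartNorm I ζ v ≠ 1) :
    ∀ᶠ r in 𝓝[>] (0 : ℝ), x r ∈ Metric.ball ζ r ↔ chartNorm I ζ v < 1 := by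
  have hlim := hx.tendsto_dist_div
  rcases hv.lt_or_gt with h | h
  · filter_upwards [hlim.eventually_lt_const h, self_mem_nhdsWithin] with r hr hr0
    simp only [h, iff_true, Metric.mem_ball]
    rwa [div_lt_one hr0] at hr
  · filter_upwards [hlim.eventually_const_lt h, self_mem_nhdsWithin] with r hr hr0
    simp only [h.not_gt, iff_false, Metric.mem_ball, not_lt]
    rw [one_lt_div hr0] at hr
    exact hr.le

end BlowUp

/-! ### Rescaled volume near an interior point -/

lemma lintegral_comp_add_smul {E : Type*} [NormedAddCommGroup E] [NormedSpace ℝ E]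
    [MeasurableSpace E] [BorelSpace E] [FiniteDimensional ℝ E] (μ : Measure E)
    [μ.IsAddHaarMeasure] (a : E) {r : ℝ} (hr : 0 < r) {G : E → ℝ≥0∞} (hG : Measurable G) :
    ∫⁻ y, G y ∂μ = ENNReal.ofReal (r ^ Module.finrank ℝ E) * ∫⁻ v, G (a + r • v) ∂μ := by
  have h1 : ∫⁻ v, G (a + r • v) ∂μ = ∫⁻ w, G (a + w) ∂(μ.map fun v => r • v) := by
    exact (lintegral_map (hG.comp (measurable_const_add a)) (measurable_const_smul r)).symm
  have hp : 0 < r ^ Module.finrank ℝ E := pow_pos hr _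
  rw [h1, Measure.map_addHaar_smul μ hr.ne', lintegral_smul_measure, lintegral_add_left_eq_self,
    smul_eq_mul, ← mul_assoc, ← ENNReal.ofReal_mul hp.le, abs_of_pos (inv_pos.2 hp),
    mul_inv_cancel₀ hp.ne', ENNReal.ofReal_one, one_mul]

section ChartNorm

variable {d : ℕ} {H : Type*} [TopologicalSpace H]
  {I : ModelWithCorners ℝ (EuclideanSpace ℝ (Fin d)) H}
  {M : Type*} [MetricSpace M] [ChartedSpace H M] [IsManifold I 1 M]
  [Bundle.RiemannianBundle (fun x : M => TangentSpace I x)]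

lemma volume_chartNorm_lt_top (ζ : M) (c : ℝ) :
    volume {v : EuclideanSpace ℝ (Fin d) | chartNorm I ζ v < c} < ⊤ := by
  obtain ⟨C, hC, hle⟩ := exists_norm_le_chartNorm I ζ
  refine (measure_mono fun v hv => ?_).trans_lt
    (measure_ball_lt_top (μ := volume) (x := (0 : EuclideanSpace ℝ (Fin d))) (r := C * c))
  have hv : chartNorm I ζ v < c := hv
  rw [mem_ball_zero_iff]
  exact (hle v).trans_lt (by gcongr)

lemma volume_chartNorm_pos (ζ : M) {c : ℝ} (hc : 0 < c) :
    0 < volume {v : EuclideanSpace ℝ (Fin d) | chartNorm I ζ v < c} := by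
  refine IsOpen.measure_pos volume (isOpen_lt (continuous_chartNorm I ζ) continuous_const)
    ⟨0, ?_⟩
  have := chartNorm_smul I ζ 0 (0 : EuclideanSpace ℝ (Fin d))
  simp only [zero_smul, abs_zero, zero_mul] at this
  simpa [this] using hc

end ChartNorm

section Volume

variable {d : ℕ} {H : Type*} [TopologicalSpace H]
  {I : ModelWithCorners ℝ (EuclideanSpace ℝ (Fin d)) H}
  {M : Type*} [MetricSpace M] [ChartedSpace H M] [MeasurableSpace M] [BorelSpace M]
  {Leb : Measure M}

/-- With second countability this makes `Leb` σ-finite, as needed for the Radon–Nikodym theorem. -/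
lemma IsVolumeMeasure.isLocallyFiniteMeasure (hLeb : IsVolumeMeasure I Leb) :
    IsLocallyFiniteMeasure Leb := by
  refine ⟨fun x => ?_⟩
  obtain ⟨h, hcont, hpos, hL⟩ := hLeb x
  have hx : extChartAt I x x ∈ (extChartAt I x).target := mem_extChartAt_target x
  have h1 : ∀ᶠ y in 𝓝 x, h (extChartAt I x y) < h (extChartAt I x x) + 1 ∧
      extChartAt I x y ∈ Metric.ball (extChartAt I x x) 1 ∧ y ∈ (extChartAt I x).source := by
    have hc : ContinuousAt (h ∘ extChartAt I x) x := by
      have : ContinuousOn (h ∘ extChartAt I x) (extChartAt I x).source :=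
        hcont.comp (continuousOn_extChartAt x) (extChartAt I x).mapsTo
      exact this.continuousAt (extChartAt_source_mem_nhds x)
    refine (hc.eventually_lt_const (by simp)).and
      (((continuousAt_extChartAt (I := I) x).eventually (Metric.ball_mem_nhds _ one_pos)).and
        (extChartAt_source_mem_nhds x))
  obtain ⟨U, hU, hUo, hxU⟩ := mem_nhds_iff.1 h1
  refine ⟨U, hUo.mem_nhds hxU, ?_⟩
  rw [hL U (fun y hy => (hU hy).2.2) hUo.measurableSet]
  have hsub : extChartAt I x '' U ⊆ Metric.ball (extChartAt I x x) 1 := by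
    rintro _ ⟨y, hy, rfl⟩
    exact (hU hy).2.1
  have hb : ∀ z ∈ extChartAt I x '' U,
      ENNReal.ofReal (h z) ≤ ENNReal.ofReal (h (extChartAt I x x) + 1) := by
    rintro _ ⟨y, hy, rfl⟩
    exact ENNReal.ofReal_le_ofReal (hU hy).1.le
  calc _ ≤ ∫⁻ _ in extChartAt I x '' U, ENNReal.ofReal (h (extChartAt I x x) + 1) := by
        refine setLIntegral_mono measurable_const hb
    _ = ENNReal.ofReal (h (extChartAt I x x) + 1) * volume (extChartAt I x '' U) := by simp
    _ ≤ ENNReal.ofReal (h (extChartAt I x x) + 1)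
        * volume (Metric.ball (extChartAt I x x) 1) := by gcongr
    _ < ⊤ := ENNReal.mul_lt_top ENNReal.ofReal_lt_top measure_ball_lt_top

variable [IsManifold I 1 M]
  [Bundle.RiemannianBundle (fun x : M => TangentSpace I x)]
  [IsContinuousRiemannianBundle (EuclideanSpace ℝ (Fin d)) (fun x : M => TangentSpace I x)]
  [IsRiemannianManifold I M]

/-- The volume of sets `A r` inside the balls `ball ζ r`, whose blow-ups have a limit shape. -/
lemma exists_tendsto_volume_div (hLeb : IsVolumeMeasure I Leb) {ζ : M}
    (hζ : I.IsInteriorPoint ζ) :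
    ∃ c : ℝ, 0 < c ∧ ∀ (A : ℝ → Set M) (A₀ : Set (EuclideanSpace ℝ (Fin d))),
      (∀ r, MeasurableSet (A r)) → (∀ r, A r ⊆ Metric.ball ζ r) → MeasurableSet A₀ →
      (∀ᵐ v : EuclideanSpace ℝ (Fin d), ∀ᶠ r in 𝓝[>] (0 : ℝ), blowUp I ζ r v ∈ A r ↔ v ∈ A₀) →
      Tendsto (fun r : ℝ => Leb (A r) / ENNReal.ofReal (r ^ d)) (𝓝[>] 0)
        (𝓝 (ENNReal.ofReal c * volume A₀)) := by
  classical
  obtain ⟨h, hcont, hpos, hL⟩ := hLeb ζ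
  set a := extChartAt I ζ ζ with ha
  have htgt : (extChartAt I ζ).target ∈ 𝓝 a := extChartAt_target_mem_nhds_of_isInteriorPoint hζ
  have hca : ContinuousAt h a := hcont.continuousAt htgt
  have hsymm : Tendsto (extChartAt I ζ).symm (𝓝 a) (𝓝 ζ) := by
    have := continuousAt_extChartAt_symm (I := I) ζ
    rwa [ContinuousAt, extChartAt_to_inv] at this
  refine ⟨h a, hpos a (mem_extChartAt_target ζ), fun A A₀ hA hAb hA₀ hlim => ?_⟩
  -- These bounds provide the dominating function: points of `ball ζ r` rescale into `{chartNorm <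
  -- 2}`, where the density is at most `h a + 1`. Any factor larger than `1` would do in place of
  -- `2`.
  have hev : ∀ᶠ y in 𝓝 a, (y ∈ (extChartAt I ζ).target ∧ h y < h a + 1) ∧
      chartNorm I ζ (y - a) ≤ 2 * dist ζ ((extChartAt I ζ).symm y) := by
    refine ((eventually_mem_set.2 htgt).and (hca.eventually_lt_const (by simp))).and ?_
    filter_upwards [hsymm.eventually (eventually_chartNorm_le_dist I ζ one_lt_two), htgt]
      with y hy hyt
    rwa [(extChartAt I ζ).right_inv hyt] at hy
  obtain ⟨V, hV, hVo, haV⟩ := mem_nhds_iff.1 hev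
  have hVm := hVo.measurableSet
  have hVt : V ⊆ (extChartAt I ζ).target := fun y hy => (hV hy).1.1
  -- The inverse chart and the density are controlled only on the target. Junk values off the open
  -- set `V` make them globally measurable, and the indicator in `G` removes these values.
  let Ψ : EuclideanSpace ℝ (Fin d) → M := V.piecewise (extChartAt I ζ).symm fun _ => ζ
  have hΨ : Measurable Ψ :=
    ((continuousOn_extChartAt_symm ζ).mono hVt).measurable_piecewise continuousOn_const hVm
  let k : EuclideanSpace ℝ (Fin d) → ℝ := V.piecewise h fun _ => 0
  have hk : Measurable k := (hcont.mono hVt).measurable_piecewise continuousOn_const hVm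
  let G : Set M → EuclideanSpace ℝ (Fin d) → ℝ≥0∞ := fun s =>
    (V ∩ Ψ ⁻¹' s).indicator fun y => ENNReal.ofReal (k y)
  have hG : ∀ s, MeasurableSet s → Measurable (G s) := fun s hs =>
    hk.ennreal_ofReal.indicator (hVm.inter (hΨ hs))
  have hLG : ∀ s ⊆ (extChartAt I ζ).source ∩ extChartAt I ζ ⁻¹' V, MeasurableSet s →
      Leb s = ∫⁻ y, G s y := by
    intro s hs hsm
    have himg : extChartAt I ζ '' s = V ∩ Ψ ⁻¹' s := by
      ext y
      constructor
      · rintro ⟨x, hx, rfl⟩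
        have hxV : extChartAt I ζ x ∈ V := (hs hx).2
        refine ⟨hxV, ?_⟩
        rw [mem_preimage]
        simp only [Ψ]
        rw [piecewise_eq_of_mem _ _ _ hxV, (extChartAt I ζ).left_inv (hs hx).1]
        exact hx
      · rintro ⟨hy, hys⟩
        rw [mem_preimage] at hys
        simp only [Ψ] at hys
        rw [piecewise_eq_of_mem _ _ _ hy] at hys
        exact ⟨_, hys, (extChartAt I ζ).right_inv (hVt hy)⟩
    rw [hL s (fun x hx => (hs hx).1) hsm, himg,
      ← lintegral_indicator (hVm.inter (hΨ hsm))]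
    refine lintegral_congr fun y => ?_
    simp only [G, indicator]
    split_ifs with hy
    · simp only [k]
      rw [piecewise_eq_of_mem _ _ _ hy.1]
    · rfl
  have hnhds : (extChartAt I ζ).source ∩ extChartAt I ζ ⁻¹' V ∈ 𝓝 ζ :=
    inter_mem (extChartAt_source_mem_nhds ζ)
      ((continuousAt_extChartAt (I := I) ζ).preimage_mem_nhds (hVo.mem_nhds haV))
  obtain ⟨ε, hε, hball⟩ := Metric.mem_nhds_iff.1 hnhds
  have hscale : ∀ᶠ r in 𝓝[>] (0 : ℝ), ∫⁻ v, G (A r) (a + r • v)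
      = Leb (A r) / ENNReal.ofReal (r ^ d) := by
    filter_upwards [Ioo_mem_nhdsGT hε] with r hr
    rw [hLG (A r) (((hAb r).trans (Metric.ball_subset_ball hr.2.le)).trans hball) (hA r),
      lintegral_comp_add_smul volume a hr.1 (hG _ (hA r)), finrank_euclideanSpace_fin, mul_comm]
    refine (ENNReal.mul_div_cancel_right ?_ ENNReal.ofReal_ne_top).symm
    simpa using pow_pos hr.1 d
  refine Tendsto.congr' hscale ?_
  have hint : ENNReal.ofReal (h a) * volume A₀
      = ∫⁻ v, A₀.indicator (fun _ => ENNReal.ofReal (h a)) v := by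
    rw [lintegral_indicator hA₀, setLIntegral_const]
  rw [hint]
  refine tendsto_lintegral_filter_of_dominated_convergence
    ({v | chartNorm I ζ v < 2}.indicator fun _ => ENNReal.ofReal (h a + 1)) ?_ ?_ ?_ ?_
  · exact .of_forall fun r => (hG _ (hA r)).comp (by fun_prop)
  · filter_upwards [self_mem_nhdsWithin] with r hr
    have hr : 0 < r := hr
    refine .of_forall fun v => ?_
    simp only [G]
    by_cases hv : a + r • v ∈ V ∩ Ψ ⁻¹' A r
    · have h1 : Ψ (a + r • v) = (extChartAt I ζ).symm (a + r • v) := by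
        simp only [Ψ]; rw [piecewise_eq_of_mem _ _ _ hv.1]
      have h2 := (hV hv.1).2
      have h3 : dist (Ψ (a + r • v)) ζ < r := hAb r hv.2
      rw [add_sub_cancel_left, chartNorm_smul, abs_of_pos hr, ← h1, dist_comm] at h2
      have h4 : chartNorm I ζ v < 2 := by nlinarith
      rw [indicator_of_mem hv, indicator_of_mem (by exact h4)]
      simp only [k]
      rw [piecewise_eq_of_mem _ _ _ hv.1]
      exact ENNReal.ofReal_le_ofReal (hV hv.1).1.2.le
    · rw [indicator_of_notMem hv]
      exact zero_le
  · rw [lintegral_indicator (measurableSet_lt (continuous_chartNorm I ζ).measurable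
      measurable_const), setLIntegral_const]
    exact (ENNReal.mul_lt_top ENNReal.ofReal_lt_top (volume_chartNorm_lt_top ζ 2)).ne
  · filter_upwards [hlim] with v hv
    have h0 := tendsto_add_smul_nhdsGT_zero a v
    have hmem : ∀ᶠ r in 𝓝[>] (0 : ℝ), a + r • v ∈ V := h0.eventually (hVo.mem_nhds haV)
    have hval : ∀ᶠ r in 𝓝[>] (0 : ℝ),
        A₀.indicator (fun _ => ENNReal.ofReal (h (a + r • v))) v = G (A r) (a + r • v) := by
      filter_upwards [hv, hmem] with r hr hrV
      have h1 : Ψ (a + r • v) = blowUp I ζ r v := by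
        simp only [Ψ]; rw [piecewise_eq_of_mem _ _ _ hrV]; rfl
      have h2 : a + r • v ∈ V ∩ Ψ ⁻¹' A r ↔ v ∈ A₀ := by
        rw [← hr, ← h1]; exact ⟨fun h => h.2, fun h => ⟨hrV, h⟩⟩
      simp only [G, indicator, h2]
      split_ifs
      · simp only [k]
        rw [piecewise_eq_of_mem _ _ _ hrV]
      · rfl
    refine Tendsto.congr' hval ?_
    by_cases hvA : v ∈ A₀
    · simp only [indicator_of_mem hvA]
      exact (ENNReal.continuous_ofReal.tendsto _).comp (hca.tendsto.comp h0)
    · simp only [indicator_of_notMem hvA]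
      exact tendsto_const_nhds

end Volume

/-! ### Expanding linear maps and Haar measure -/

section Linear

variable {E : Type*} [NormedAddCommGroup E] [NormedSpace ℝ E] [FiniteDimensional ℝ E]
  [MeasurableSpace E] [BorelSpace E] (ν : Measure E) [ν.IsAddHaarMeasure]

lemma addHaar_preimage_iterate (L : E ≃L[ℝ] E) (j : ℕ) (s : Set E) :
    ν (L^[j] ⁻¹' s) = ENNReal.ofReal |(L.symm : E →L[ℝ] E).det| ^ j * ν s := by
  induction j generalizing s with
  | zero => simp
  | succ j ih =>
    have h : L^[j + 1] ⁻¹' s = L^[j] ⁻¹' (L ⁻¹' s) := by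
      ext x
      simp only [mem_preimage, Function.iterate_succ_apply']
    rw [h, ih, Measure.addHaar_preimage_continuousLinearEquiv, ← mul_assoc, pow_succ]
    rfl

lemma addHaar_preimage_iterate_eq_zero (L : E ≃L[ℝ] E) (j : ℕ) {s : Set E} (hs : ν s = 0) :
    ν (L^[j] ⁻¹' s) = 0 := by
  rw [addHaar_preimage_iterate, hs, mul_zero]

/-- If almost no orbit of the expanding map `L` that leaves the neighbourhood `U` of `0` comes
back to `U`, then `U` contains almost all of its preimage. -/
lemma addHaar_inter_preimage_of_repelling (L : E ≃L[ℝ] E)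
    (hdet : |(L.symm : E →L[ℝ] E).det| < 1)
    (hcontr : ∀ v : E, Tendsto (fun k : ℕ => L.symm^[k] v) atTop (𝓝 0))
    {U : Set E} (hU : U ∈ 𝓝 0) (hUfin : ν U ≠ ⊤)
    (hnull : ∀ j : ℕ, 1 ≤ j →
      ν {v | v ∈ U ∧ L v ∉ U ∧ L^[j] v ∈ U ∧ L^[j + 1] v ∉ U} = 0) :
    ν (U ∩ L ⁻¹' U) = ENNReal.ofReal |(L.symm : E →L[ℝ] E).det| * ν U := by
  set K : Set E := {v | ∀ j : ℕ, L^[j] v ∈ U} with hKdef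
  -- Points that never leave `U` lie in every `L⁻ʲU`, whose measure decays geometrically.
  have hK : ν K = 0 := by
    have hle : ∀ j : ℕ, ν K ≤ ENNReal.ofReal |(L.symm : E →L[ℝ] E).det| ^ j * ν U := by
      intro j
      rw [← addHaar_preimage_iterate]
      exact measure_mono fun v hv => hv j
    have hlim : Tendsto (fun j : ℕ => ENNReal.ofReal |(L.symm : E →L[ℝ] E).det| ^ j * ν U)
        atTop (𝓝 (0 * ν U)) :=
      ENNReal.Tendsto.mul_const
        (ENNReal.tendsto_pow_atTop_nhds_zero_of_lt_one (by simpa using hdet)) (Or.inr hUfin)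
    rw [zero_mul] at hlim
    exact le_antisymm (ge_of_tendsto' hlim hle) zero_le
  have hiter : ∀ (m : ℕ) (y : E), L^[m] (L.symm^[m] y) = y := fun m y =>
    (L.toEquiv.right_inv.iterate m) y
  have hY : ν (L ⁻¹' U \ U) = 0 := by
    refine measure_mono_null (t := (L^[1] ⁻¹' K) ∪ ⋃ m : ℕ, ⋃ j ∈ Ici 1,
      L.symm^[m] ⁻¹' {v | v ∈ U ∧ L v ∉ U ∧ L^[j] v ∈ U ∧ L^[j + 1] v ∉ U}) ?_ ?_
    · rintro y ⟨hLy, hy⟩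
      by_cases hyK : L y ∈ K
      · exact Or.inl hyK
      right
      obtain ⟨i, hi⟩ : ∃ i : ℕ, L^[i] (L y) ∉ U := by simpa [hKdef] using hyK
      have hex : ∃ m : ℕ, L.symm^[m] y ∈ U := ((hcontr y).eventually hU).exists
      classical
      -- The first backward entrance into `U`. Read forwards from `L.symm^[m + 1] y`, it is a first
      -- escape; the first exit of the orbit of `L y` found below is a second one.
      obtain ⟨m, hm, hmin⟩ : ∃ m : ℕ, L.symm^[m + 1] y ∈ U ∧ L.symm^[m] y ∉ U := by
        have hne : Nat.find hex ≠ 0 := fun h0 => hy (by simpa [h0] using Nat.find_spec hex)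
        obtain ⟨m, hm⟩ := Nat.exists_eq_succ_of_ne_zero hne
        exact ⟨m, by simpa [hm] using Nat.find_spec hex, Nat.find_min hex (by omega)⟩
      have hex' : ∃ i : ℕ, L^[i] (L y) ∉ U := ⟨i, hi⟩
      obtain ⟨k, hk, hkmin⟩ : ∃ k : ℕ, L^[k + 1] (L y) ∉ U ∧ L^[k] (L y) ∈ U := by
        have hne : Nat.find hex' ≠ 0 := fun h0 => by
          have := Nat.find_spec hex'
          rw [h0] at this
          exact this hLy
        obtain ⟨k, hk⟩ := Nat.exists_eq_succ_of_ne_zero hne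
        refine ⟨k, by simpa [hk] using Nat.find_spec hex', ?_⟩
        by_contra hcon
        exact Nat.find_min hex' (by omega) hcon
      simp only [mem_iUnion]
      have hback : ∀ i : ℕ, L^[i + (m + 2)] (L.symm^[m + 1] y) = L^[i] (L y) := by
        intro i
        rw [show i + (m + 2) = (i + 1) + (m + 1) by omega, Function.iterate_add_apply, hiter,
          Function.iterate_succ_apply]
      -- Going from `L.symm^[m + 1] y` to `L y` takes `m + 2` steps, and `k` more steps lead to the
      -- last point before the second escape.
      refine ⟨m + 1, k + (m + 2), show 1 ≤ _ by omega, hm, ?_, ?_, ?_⟩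
      · rw [Function.iterate_succ_apply', L.apply_symm_apply]
        exact hmin
      · rw [hback]
        exact hkmin
      · rw [show k + (m + 2) + 1 = (k + 1) + (m + 2) by omega, hback]
        exact hk
    · refine measure_union_null (addHaar_preimage_iterate_eq_zero ν L 1 hK) ?_
      refine measure_iUnion_null fun m => (measure_biUnion_null_iff (to_countable _)).2
        fun j hj => addHaar_preimage_iterate_eq_zero ν L.symm m (hnull j hj)
  rw [← pow_one (ENNReal.ofReal _), ← addHaar_preimage_iterate ν L 1 U,
    Function.iterate_one]
  refine le_antisymm (measure_mono inter_subset_right) ?_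
  have := measure_le_inter_add_sdiff ν (L ⁻¹' U) U
  rwa [hY, add_zero, inter_comm] at this

end Linear

section ChartNorm

variable {d : ℕ} {H : Type*} [TopologicalSpace H]
  {I : ModelWithCorners ℝ (EuclideanSpace ℝ (Fin d)) H}
  {M : Type*} [MetricSpace M] [ChartedSpace H M] [IsManifold I 1 M]
  [Bundle.RiemannianBundle (fun x : M => TangentSpace I x)]

/-- The unit sphere lies in the frontier of the convex open unit ball, and the frontier of a convex
set is null. -/
lemma ae_chartNorm_ne_one (ζ : M) :
    ∀ᵐ v : EuclideanSpace ℝ (Fin d), chartNorm I ζ v ≠ 1 := by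
  set U : Set (EuclideanSpace ℝ (Fin d)) := {v | chartNorm I ζ v < 1} with hU
  have hconv : Convex ℝ U := by
    intro v hv w hw s t hs ht hst
    have hv : chartNorm I ζ v < 1 := hv
    have hw : chartNorm I ζ w < 1 := hw
    have h1 := chartNorm_add_le I ζ (s • v) (t • w)
    rw [chartNorm_smul, chartNorm_smul, abs_of_nonneg hs, abs_of_nonneg ht] at h1
    change chartNorm I ζ (s • v + t • w) < 1
    rcases hs.eq_or_lt with h | h
    · have : t = 1 := by linarith
      subst h this
      linarith
    · nlinarith
  have hopen : IsOpen U := isOpen_lt (continuous_chartNorm I ζ) continuous_const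
  refine measure_mono_null (fun v hv => ?_) (hconv.addHaar_frontier volume)
  have hv : chartNorm I ζ v = 1 := by simpa using hv
  refine ⟨?_, fun h => ?_⟩
  · have hlim : Tendsto (fun c : ℝ => c • v) (𝓝[Ioo 0 1] 1) (𝓝 v) := by
      have : Continuous fun c : ℝ => c • v := by fun_prop
      simpa using (this.tendsto 1).mono_left nhdsWithin_le_nhds
    have : (𝓝[Ioo (0 : ℝ) 1] 1).NeBot := by
      rw [← mem_closure_iff_nhdsWithin_neBot, closure_Ioo zero_ne_one]
      exact right_mem_Icc.2 zero_le_one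
    refine mem_closure_of_tendsto hlim ?_
    filter_upwards [self_mem_nhdsWithin] with c hc
    change chartNorm I ζ (c • v) < 1
    rw [chartNorm_smul, abs_of_pos hc.1, hv, mul_one]
    exact hc.2
  · rw [hopen.interior_eq] at h
    exact absurd hv (ne_of_lt h)

lemma ae_chartNorm_iterate_ne_one (ζ : M)
    (L : EuclideanSpace ℝ (Fin d) ≃L[ℝ] EuclideanSpace ℝ (Fin d)) :
    ∀ᵐ v : EuclideanSpace ℝ (Fin d), ∀ j : ℕ, chartNorm I ζ (L^[j] v) ≠ 1 :=
  ae_all_iff.2 fun j => addHaar_preimage_iterate_eq_zero volume L j (ae_chartNorm_ne_one ζ)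

end ChartNorm

/-! ### The measure near a Lebesgue point, and the escape ratio -/

/-- Inside a set `B` the measure `μ` differs from `ρ • Leb` by the mean deviation of its density
from `ρ`. -/
lemma abs_measureReal_sub_mul_le {M : Type*} [MeasurableSpace M] {μ Leb : Measure M}
    [IsFiniteMeasure μ] [SigmaFinite Leb] (hμ : μ ≪ Leb) {ρ : ℝ} (hρ : 0 ≤ ρ) {A B : Set M}
    (hAB : A ⊆ B) (hB : Leb B ≠ ⊤) (hB0 : Leb B ≠ 0)
    (hfin : ∫⁻ x in B, ‖(μ.rnDeriv Leb x).toReal - ρ‖ₑ ∂Leb ≠ ⊤) :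
    |μ.real A - ρ * Leb.real A| ≤
      ((∫⁻ x in B, ‖(μ.rnDeriv Leb x).toReal - ρ‖ₑ ∂Leb) / Leb B).toReal * Leb.real B := by
  set e := ∫⁻ x in B, ‖(μ.rnDeriv Leb x).toReal - ρ‖ₑ ∂Leb with he
  have hmeas : Measurable fun x => ‖(μ.rnDeriv Leb x).toReal - ρ‖ₑ :=
    ((Measure.measurable_rnDeriv μ Leb).ennreal_toReal.sub_const ρ).enorm
  have hAe : ∫⁻ x in A, ‖(μ.rnDeriv Leb x).toReal - ρ‖ₑ ∂Leb ≤ e := lintegral_mono_set hAB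
  have hA : Leb A ≠ ⊤ := ne_top_of_le_ne_top hB (measure_mono hAB)
  have hae : ∀ᵐ x ∂(Leb.restrict A), μ.rnDeriv Leb x < ⊤ :=
    ae_restrict_of_ae (Measure.rnDeriv_lt_top μ Leb)
  have h1 : μ A ≤ ENNReal.ofReal ρ * Leb A + e := by
    calc μ A = ∫⁻ x in A, μ.rnDeriv Leb x ∂Leb := (Measure.setLIntegral_rnDeriv hμ A).symm
      _ ≤ ∫⁻ x in A, (ENNReal.ofReal ρ + ‖(μ.rnDeriv Leb x).toReal - ρ‖ₑ) ∂Leb := by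
        refine lintegral_mono_ae ?_
        filter_upwards [hae] with x hx
        rw [← ofReal_norm, Real.norm_eq_abs, ← ENNReal.ofReal_add hρ (abs_nonneg _)]
        refine ENNReal.le_ofReal_iff_toReal_le hx.ne (by positivity) |>.2 ?_
        linarith [le_abs_self ((μ.rnDeriv Leb x).toReal - ρ)]
      _ = ENNReal.ofReal ρ * Leb A + ∫⁻ x in A, ‖(μ.rnDeriv Leb x).toReal - ρ‖ₑ ∂Leb := by
        rw [lintegral_add_left measurable_const, setLIntegral_const]
      _ ≤ _ := by gcongr
  have h2 : ENNReal.ofReal ρ * Leb A ≤ μ A + e := by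
    calc ENNReal.ofReal ρ * Leb A = ∫⁻ x in A, ENNReal.ofReal ρ ∂Leb := by rw [setLIntegral_const]
      _ ≤ ∫⁻ x in A, (μ.rnDeriv Leb x + ‖(μ.rnDeriv Leb x).toReal - ρ‖ₑ) ∂Leb := by
        refine lintegral_mono_ae ?_
        filter_upwards [hae] with x hx
        rw [← ofReal_norm, Real.norm_eq_abs]
        nth_rewrite 1 [← ENNReal.ofReal_toReal hx.ne]
        rw [← ENNReal.ofReal_add ENNReal.toReal_nonneg (abs_nonneg _)]
        refine ENNReal.ofReal_le_ofReal ?_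
        linarith [neg_abs_le ((μ.rnDeriv Leb x).toReal - ρ)]
      _ = μ A + ∫⁻ x in A, ‖(μ.rnDeriv Leb x).toReal - ρ‖ₑ ∂Leb := by
        rw [lintegral_add_left (Measure.measurable_rnDeriv μ Leb),
          Measure.setLIntegral_rnDeriv hμ]
      _ ≤ _ := by gcongr
  -- The bound is just the total deviation `e`; it is stated through the mean because the mean is
  -- what vanishes at a Lebesgue point.
  have hre : (e / Leb B).toReal * Leb.real B = e.toReal := by
    rw [measureReal_def, ← ENNReal.toReal_mul, ENNReal.div_mul_cancel hB0 hB]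
  rw [hre, abs_le]
  have h1' := ENNReal.toReal_mono (by finiteness) h1
  have h2' := ENNReal.toReal_mono (by finiteness) h2
  rw [ENNReal.toReal_add (by finiteness) hfin, ENNReal.toReal_mul, ENNReal.toReal_ofReal hρ] at h1'
  rw [ENNReal.toReal_add (by finiteness) hfin, ENNReal.toReal_mul, ENNReal.toReal_ofReal hρ] at h2'
  simp only [measureReal_def]
  constructor <;> linarith

section Density

variable {d : ℕ} {H : Type*} [TopologicalSpace H]
  {I : ModelWithCorners ℝ (EuclideanSpace ℝ (Fin d)) H}
  {M : Type*} [MetricSpace M] [SecondCountableTopology M] [ChartedSpace H M] [IsManifold I 1 M]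
  [Bundle.RiemannianBundle (fun x : M => TangentSpace I x)]
  [IsContinuousRiemannianBundle (EuclideanSpace ℝ (Fin d)) (fun x : M => TangentSpace I x)]
  [IsRiemannianManifold I M] [MeasurableSpace M] [BorelSpace M] {Leb : Measure M}
  {μ : Measure M} [IsFiniteMeasure μ] {ζ : M} {ρ : ℝ}

/-- Asymptotics of `μ` near a Lebesgue point of its density. -/
lemma exists_tendsto_measureReal_div (hLeb : IsVolumeMeasure I Leb) (hμ : μ ≪ Leb)
    (hζ : I.IsInteriorPoint ζ) (hρ : 0 < ρ) (hdens : IsLebesguePoint μ Leb ζ ρ) :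
    ∃ c : ℝ, 0 < c ∧ ∀ (A : ℝ → Set M) (A₀ : Set (EuclideanSpace ℝ (Fin d))),
      (∀ r, MeasurableSet (A r)) → (∀ r, A r ⊆ Metric.ball ζ r) → MeasurableSet A₀ →
      A₀ ⊆ {v | chartNorm I ζ v < 1} →
      (∀ᵐ v : EuclideanSpace ℝ (Fin d), ∀ᶠ r in 𝓝[>] (0 : ℝ), blowUp I ζ r v ∈ A r ↔ v ∈ A₀) →
      Tendsto (fun r : ℝ => μ.real (A r) / r ^ d) (𝓝[>] 0) (𝓝 (c * volume.real A₀)) := by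
  have := hLeb.isLocallyFiniteMeasure
  obtain ⟨c, hc, hvol⟩ := exists_tendsto_volume_div hLeb hζ
  refine ⟨ρ * c, by positivity, fun A A₀ hA hAb hA₀ hA₀1 hlim => ?_⟩
  set U : Set (EuclideanSpace ℝ (Fin d)) := {v | chartNorm I ζ v < 1} with hU
  have hUm : MeasurableSet U :=
    measurableSet_lt (continuous_chartNorm I ζ).measurable measurable_const
  have hUfin : volume U < ⊤ := volume_chartNorm_lt_top ζ 1
  have hUpos : 0 < volume U := volume_chartNorm_pos ζ one_pos
  have toReal : ∀ (S : ℝ → Set M) (S₀ : Set (EuclideanSpace ℝ (Fin d))), S₀ ⊆ U →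
      Tendsto (fun r : ℝ => Leb (S r) / ENNReal.ofReal (r ^ d)) (𝓝[>] 0)
        (𝓝 (ENNReal.ofReal c * volume S₀)) →
      Tendsto (fun r : ℝ => Leb.real (S r) / r ^ d) (𝓝[>] 0) (𝓝 (c * volume.real S₀)) := by
    intro S S₀ hS h
    have hfin : volume S₀ ≠ ⊤ := ne_top_of_le_ne_top hUfin.ne (measure_mono hS)
    have h2 := (ENNReal.tendsto_toReal
      (ENNReal.mul_ne_top ENNReal.ofReal_ne_top hfin)).comp h
    rw [ENNReal.toReal_mul, ENNReal.toReal_ofReal hc.le] at h2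
    refine h2.congr' ?_
    filter_upwards [self_mem_nhdsWithin] with r hr
    have hr : 0 < r := hr
    simp only [Function.comp_apply, ENNReal.toReal_div, measureReal_def]
    rw [ENNReal.toReal_ofReal (by positivity)]
  have hball0 : Tendsto (fun r : ℝ => Leb (Metric.ball ζ r) / ENNReal.ofReal (r ^ d)) (𝓝[>] 0)
      (𝓝 (ENNReal.ofReal c * volume U)) := by
    refine hvol (fun r => Metric.ball ζ r) U (fun r => Metric.isOpen_ball.measurableSet)
      (fun r => subset_rfl) hUm ?_
    filter_upwards [ae_chartNorm_ne_one (I := I) ζ] with v hv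
    exact (hasVelocity_blowUp hζ v).eventually_mem_ball_iff hv
  have hball := toReal _ U subset_rfl hball0
  have hAlim := toReal A A₀ hA₀1 (hvol A A₀ hA hAb hA₀ hlim)
  have hBpos : ∀ᶠ r in 𝓝[>] (0 : ℝ), Leb (Metric.ball ζ r) ≠ 0 := by
    have : ENNReal.ofReal c * volume U ≠ 0 := by
      simp [hUpos.ne', hc]
    filter_upwards [hball0.eventually_ne this] with r hr h0
    simp [h0] at hr
  have hBfin : ∀ᶠ r in 𝓝[>] (0 : ℝ), Leb (Metric.ball ζ r) ≠ ⊤ := by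
    obtain ⟨W, hW, hWfin⟩ := this.finiteAtNhds ζ
    obtain ⟨ε, hε, hball⟩ := Metric.mem_nhds_iff.1 hW
    filter_upwards [Ioo_mem_nhdsGT hε] with r hr
    exact ((measure_mono ((Metric.ball_subset_ball hr.2.le).trans hball)).trans_lt hWfin).ne
  have hdens' : Tendsto (fun r : ℝ =>
      ((∫⁻ x in Metric.ball ζ r, ‖(μ.rnDeriv Leb x).toReal - ρ‖ₑ ∂Leb)
        / Leb (Metric.ball ζ r)).toReal * (Leb.real (Metric.ball ζ r) / r ^ d)) (𝓝[>] 0) (𝓝 0) := by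
    have h := (ENNReal.tendsto_toReal ENNReal.zero_ne_top).comp hdens
    simpa using h.mul hball
  -- An infinite integral would make the quotient infinite, not small, since the ball has finite
  -- volume.
  have hefin : ∀ᶠ r in 𝓝[>] (0 : ℝ),
      ∫⁻ x in Metric.ball ζ r, ‖(μ.rnDeriv Leb x).toReal - ρ‖ₑ ∂Leb ≠ ⊤ := by
    have h1 : ∀ᶠ r in 𝓝[>] (0 : ℝ), (∫⁻ x in Metric.ball ζ r,
        ‖(μ.rnDeriv Leb x).toReal - ρ‖ₑ ∂Leb) / Leb (Metric.ball ζ r) < 1 :=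
      hdens.eventually_lt_const one_pos
    filter_upwards [h1, hBfin] with r hr hfin htop
    rw [htop, ENNReal.top_div_of_ne_top hfin] at hr
    exact absurd hr (by simp)
  have hdiff : Tendsto (fun r : ℝ => μ.real (A r) / r ^ d - ρ * (Leb.real (A r) / r ^ d))
      (𝓝[>] 0) (𝓝 0) := by
    refine squeeze_zero_norm' ?_ hdens'
    filter_upwards [hBpos, hBfin, hefin, self_mem_nhdsWithin] with r h0 h1 h2 hr
    have hr : 0 < r ^ d := pow_pos hr d
    have h3 := abs_measureReal_sub_mul_le hμ hρ.le (hAb r) h1 h0 h2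
    rw [Real.norm_eq_abs, ← mul_div_assoc, ← sub_div, abs_div, abs_of_pos hr, ← mul_div_assoc]
    gcongr
  have := hdiff.add (hAlim.const_mul ρ)
  simpa [mul_assoc] using this

end Density

section Density

variable {d : ℕ} {H : Type*} [TopologicalSpace H]
  {I : ModelWithCorners ℝ (EuclideanSpace ℝ (Fin d)) H}
  {M : Type*} [MetricSpace M] [SecondCountableTopology M] [ChartedSpace H M] [IsManifold I 1 M]
  [Bundle.RiemannianBundle (fun x : M => TangentSpace I x)]
  [IsContinuousRiemannianBundle (EuclideanSpace ℝ (Fin d)) (fun x : M => TangentSpace I x)]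
  [IsRiemannianManifold I M] [MeasurableSpace M] [BorelSpace M] {Leb : Measure M}
  {μ : Measure M} [IsFiniteMeasure μ] {ζ : M} {ρ : ℝ}

/-- The measure of the ball is asymptotic to a positive constant times `r ^ d`; monotonicity extends
positivity to all radii. Vanishing needs `0 < d` because `r ^ 0 = 1`. -/
lemma measureReal_ball_pos_and_tendsto (hLeb : IsVolumeMeasure I Leb) (hμ : μ ≪ Leb)
    (hζ : I.IsInteriorPoint ζ) (hρ : 0 < ρ) (hdens : IsLebesguePoint μ Leb ζ ρ) :
    (∀ r : ℝ, 0 < r → 0 < μ.real (Metric.ball ζ r)) ∧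
      (0 < d → Tendsto (fun r : ℝ => μ.real (Metric.ball ζ r)) (𝓝[>] 0) (𝓝 0)) := by
  obtain ⟨c, hc, hlim⟩ := exists_tendsto_measureReal_div hLeb hμ hζ hρ hdens
  have hball := hlim (fun r => Metric.ball ζ r) {v | chartNorm I ζ v < 1}
    (fun r => Metric.isOpen_ball.measurableSet) (fun r => subset_rfl)
    (measurableSet_lt (continuous_chartNorm I ζ).measurable measurable_const) subset_rfl (by
      filter_upwards [ae_chartNorm_ne_one (I := I) ζ] with v hv
      exact (hasVelocity_blowUp hζ v).eventually_mem_ball_iff hv)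
  have hvol : 0 < volume.real {v : EuclideanSpace ℝ (Fin d) | chartNorm I ζ v < 1} :=
    ENNReal.toReal_pos (volume_chartNorm_pos ζ one_pos).ne' (volume_chartNorm_lt_top ζ 1).ne
  constructor
  · intro r hr
    obtain ⟨s, hs, hs0⟩ := ((hball.eventually_const_lt (by positivity :
      0 < c * volume.real {v : EuclideanSpace ℝ (Fin d) | chartNorm I ζ v < 1})).and
        (Ioo_mem_nhdsGT hr)).exists
    have hs1 : 0 < μ.real (Metric.ball ζ s) := by
      by_contra hcon
      have h0 : μ.real (Metric.ball ζ s) = 0 := le_antisymm (not_lt.1 hcon) measureReal_nonneg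
      simp [h0] at hs
    exact hs1.trans_le (measureReal_mono (Metric.ball_subset_ball hs0.2.le))
  · intro hd
    have hpow : Tendsto (fun r : ℝ => r ^ d) (𝓝[>] 0) (𝓝 0) := by
      have : Continuous fun r : ℝ => r ^ d := by fun_prop
      simpa [hd.ne'] using (this.tendsto 0).mono_left nhdsWithin_le_nhds
    have h := hball.mul hpow
    rw [mul_zero] at h
    refine h.congr' ?_
    filter_upwards [self_mem_nhdsWithin] with r hr
    have hr : 0 < r := hr
    field_simp

/-- The proportion of the ball of radius `r` at a repelling fixed point of `F` which leaves the
ball under `F` has a limit as `r → 0`; it is `1 - |det L⁻¹|` as soon as orbits that left the ball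
do not come back. -/
lemma exists_tendsto_escape_div (hLeb : IsVolumeMeasure I Leb) (hμ : μ ≪ Leb)
    (hζ : I.IsInteriorPoint ζ) (hρ : 0 < ρ) (hdens : IsLebesguePoint μ Leb ζ ρ)
    {F : M → M} (hFm : Measurable F) (hF : F ζ = ζ) (hc : ContinuousAt F ζ)
    (L : EuclideanSpace ℝ (Fin d) ≃L[ℝ] EuclideanSpace ℝ (Fin d))
    (hd : HasFDerivWithinAt (extChartAt I ζ ∘ F ∘ (extChartAt I ζ).symm)
      (L : EuclideanSpace ℝ (Fin d) →L[ℝ] EuclideanSpace ℝ (Fin d)) (range I)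
      (extChartAt I ζ ζ))
    (hdet : |(L.symm : EuclideanSpace ℝ (Fin d) →L[ℝ] EuclideanSpace ℝ (Fin d)).det| < 1)
    (hcontr : ∀ v, Tendsto (fun k : ℕ => L.symm^[k] v) atTop (𝓝 0)) :
    ∃ κ : ℝ,
      1 - |(L.symm : EuclideanSpace ℝ (Fin d) →L[ℝ] EuclideanSpace ℝ (Fin d)).det| ≤ κ ∧
      Tendsto (fun r : ℝ => μ.real (Metric.ball ζ r \ F ⁻¹' Metric.ball ζ r)
        / μ.real (Metric.ball ζ r)) (𝓝[>] 0) (𝓝 κ) ∧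
      ((∀ j : ℕ, 1 ≤ j → ∃ r : ℕ → ℝ, Tendsto r atTop (𝓝[>] 0) ∧
        Tendsto (fun n => μ.real ((Metric.ball ζ (r n) \ F ⁻¹' Metric.ball ζ (r n)) ∩
          F^[j] ⁻¹' (Metric.ball ζ (r n) \ F ⁻¹' Metric.ball ζ (r n)))
            / μ.real (Metric.ball ζ (r n))) atTop (𝓝 0)) →
        κ = 1 - |(L.symm : EuclideanSpace ℝ (Fin d) →L[ℝ] EuclideanSpace ℝ (Fin d)).det|) := by
  obtain ⟨c, hc0, hlim⟩ := exists_tendsto_measureReal_div hLeb hμ hζ hρ hdens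
  set U : Set (EuclideanSpace ℝ (Fin d)) := {v | chartNorm I ζ v < 1} with hU
  set D := |(L.symm : EuclideanSpace ℝ (Fin d) →L[ℝ] EuclideanSpace ℝ (Fin d)).det| with hD
  have hUo : IsOpen U := isOpen_lt (continuous_chartNorm I ζ) continuous_const
  have hUm : MeasurableSet U := hUo.measurableSet
  have hUfin : volume U < ⊤ := volume_chartNorm_lt_top ζ 1
  have hUpos : 0 < volume.real U :=
    ENNReal.toReal_pos (volume_chartNorm_pos ζ one_pos).ne' hUfin.ne
  have hLm : Measurable L := L.continuous.measurable
  have hbm : ∀ r, MeasurableSet (Metric.ball ζ r) := fun r => Metric.isOpen_ball.measurableSet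
  have hev : ∀ᵐ v : EuclideanSpace ℝ (Fin d), ∀ j : ℕ, ∀ᶠ r in 𝓝[>] (0 : ℝ),
      F^[j] (blowUp I ζ r v) ∈ Metric.ball ζ r ↔ L^[j] v ∈ U := by
    filter_upwards [ae_chartNorm_iterate_ne_one (I := I) ζ L] with v hv j
    exact ((hasVelocity_blowUp hζ v).iterate hF hc hd j).eventually_mem_ball_iff (hv j)
  have hball : Tendsto (fun r : ℝ => μ.real (Metric.ball ζ r) / r ^ d) (𝓝[>] 0)
      (𝓝 (c * volume.real U)) := by
    refine hlim _ U hbm (fun r => subset_rfl) hUm subset_rfl ?_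
    filter_upwards [hev] with v hv using hv 0
  have hratio : ∀ (A : ℝ → Set M) (A₀ : Set (EuclideanSpace ℝ (Fin d))),
      (∀ r, MeasurableSet (A r)) → (∀ r, A r ⊆ Metric.ball ζ r) → MeasurableSet A₀ → A₀ ⊆ U →
      (∀ᵐ v : EuclideanSpace ℝ (Fin d), ∀ᶠ r in 𝓝[>] (0 : ℝ), blowUp I ζ r v ∈ A r ↔ v ∈ A₀) →
      Tendsto (fun r : ℝ => μ.real (A r) / μ.real (Metric.ball ζ r)) (𝓝[>] 0)
        (𝓝 (volume.real A₀ / volume.real U)) := by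
    intro A A₀ h1 h2 h3 h4 h5
    have h := (hlim A A₀ h1 h2 h3 h4 h5).div hball (by positivity)
    rw [mul_div_mul_left _ _ hc0.ne'] at h
    refine h.congr' ?_
    filter_upwards [self_mem_nhdsWithin] with r hr
    have hr : 0 < r ^ d := pow_pos hr d
    exact div_div_div_cancel_right₀ hr.ne' _ _
  have hesc := hratio (fun r => Metric.ball ζ r \ F ⁻¹' Metric.ball ζ r) (U \ L ⁻¹' U)
    (fun r => (hbm r).diff (hFm (hbm r))) (fun r => sdiff_subset) (hUm.diff (hLm hUm)) sdiff_subset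
    (by
      filter_upwards [hev] with v hv
      filter_upwards [hv 0, hv 1] with r h0 h1
      exact and_congr h0 (not_congr h1))
  have hsplit : volume.real (U \ L ⁻¹' U) = volume.real U - volume.real (U ∩ L ⁻¹' U) := by
    have := measureReal_inter_add_sdiff (μ := volume) (s := U) (hLm hUm) hUfin.ne
    linarith
  have hpre : volume (L ⁻¹' U) = ENNReal.ofReal D * volume U := by
    rw [← pow_one (ENNReal.ofReal D)]
    exact addHaar_preimage_iterate volume L 1 U
  refine ⟨volume.real (U \ L ⁻¹' U) / volume.real U, ?_, hesc, fun hret => ?_⟩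
  -- The inequality for `κ` uses no dynamics beyond `L`; equality would need `L⁻¹U ⊆ U` up to a null
  -- set.
  · have h1 : volume.real (U ∩ L ⁻¹' U) ≤ D * volume.real U := by
      have := ENNReal.toReal_mono (by rw [hpre]; finiteness)
        (measure_mono (μ := volume) (inter_subset_right : U ∩ L ⁻¹' U ⊆ L ⁻¹' U))
      rwa [hpre, ENNReal.toReal_mul, ENNReal.toReal_ofReal (abs_nonneg _)] at this
    rw [hsplit, le_div_iff₀ hUpos]
    linarith
  · have hnull : ∀ j : ℕ, 1 ≤ j →
        volume {v | v ∈ U ∧ L v ∉ U ∧ L^[j] v ∈ U ∧ L^[j + 1] v ∉ U} = 0 := by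
      intro j hj
      set A₀ := {v | v ∈ U ∧ L v ∉ U ∧ L^[j] v ∈ U ∧ L^[j + 1] v ∉ U} with hA₀
      have hA₀U : A₀ ⊆ U := fun v hv => hv.1
      have hA₀m : MeasurableSet A₀ := by
        have h1 : MeasurableSet (L^[j] ⁻¹' U) := (hLm.iterate j) hUm
        have h2 : MeasurableSet (L^[j + 1] ⁻¹' U) := (hLm.iterate (j + 1)) hUm
        exact hUm.inter ((hLm hUm).compl.inter (h1.inter h2.compl))
      have h := hratio (fun r => (Metric.ball ζ r \ F ⁻¹' Metric.ball ζ r) ∩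
          F^[j] ⁻¹' (Metric.ball ζ r \ F ⁻¹' Metric.ball ζ r)) A₀
        (fun r => ((hbm r).diff (hFm (hbm r))).inter
          ((hFm.iterate j) ((hbm r).diff (hFm (hbm r)))))
        (fun r => inter_subset_left.trans sdiff_subset) hA₀m hA₀U (by
          filter_upwards [hev] with v hv
          filter_upwards [hv 0, hv 1, hv j, hv (j + 1)] with r h0 h1 h2 h3
          rw [Function.iterate_succ_apply'] at h3
          exact ((and_congr h0 (not_congr h1)).and (and_congr h2 (not_congr h3))).trans
            and_assoc)
      -- The limit over all radii exists by the blow-up, so its value can be read off along the one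
      -- sequence where returns are known to be negligible.
      obtain ⟨r, hr, hr0⟩ := hret j hj
      have h0 := tendsto_nhds_unique (h.comp hr) hr0
      have h1 : volume.real A₀ = 0 := by
        rcases div_eq_zero_iff.1 h0 with h | h
        · exact h
        · exact absurd h hUpos.ne'
      exact (measureReal_eq_zero_iff
        (ne_top_of_le_ne_top hUfin.ne (measure_mono hA₀U))).1 h1
    have hU0 : U ∈ 𝓝 (0 : EuclideanSpace ℝ (Fin d)) := by
      refine hUo.mem_nhds ?_
      have := chartNorm_smul I ζ 0 (0 : EuclideanSpace ℝ (Fin d))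
      simp only [zero_smul, abs_zero, zero_mul] at this
      simp [hU, this]
    have hkey := addHaar_inter_preimage_of_repelling volume L hdet hcontr hU0 hUfin.ne hnull
    have hkey' : volume.real (U ∩ L ⁻¹' U) = D * volume.real U := by
      rw [measureReal_def, hkey, ENNReal.toReal_mul, ENNReal.toReal_ofReal (abs_nonneg _)]
      rfl
    rw [hsplit, hkey']
    field_simp

end Density

/-! ### Avoiding a set over long windows: block estimates -/

/-- The points whose orbit avoids `A` at the times `s, …, s + ℓ - 1`. -/
def avoid {M : Type*} (f : M → M) (A : Set M) (s ℓ : ℕ) : Set M :=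
  {x | ∀ i, s ≤ i → i < s + ℓ → f^[i] x ∉ A}

section Avoid

variable {M : Type*} {f : M → M} {A : Set M}

lemma preimage_iterate_avoid (i s ℓ : ℕ) : f^[i] ⁻¹' avoid f A s ℓ = avoid f A (s + i) ℓ := by
  ext x
  simp only [avoid, mem_preimage, mem_ofPred_eq, ← Function.iterate_add_apply]
  constructor
  · intro h j h1 h2
    have := h (j - i) (by omega) (by omega)
    rwa [Nat.sub_add_cancel (by omega)] at this
  · intro h j h1 h2
    exact h (j + i) (by omega) (by omega)

lemma avoid_zero_length (s : ℕ) : avoid f A s 0 = univ := by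
  ext x; simp only [avoid, mem_ofPred_eq, mem_univ, iff_true]; intro i; omega

lemma avoid_antitone (s : ℕ) {ℓ ℓ' : ℕ} (h : ℓ ≤ ℓ') : avoid f A s ℓ' ⊆ avoid f A s ℓ :=
  fun _ hx i h1 h2 => hx i h1 (by omega)

variable [MeasurableSpace M]

lemma measurableSet_avoid (hf : Measurable f) (hA : MeasurableSet A) (s ℓ : ℕ) :
    MeasurableSet (avoid f A s ℓ) := by
  have : avoid f A s ℓ = ⋂ i ∈ Finset.Ico s (s + ℓ), (f^[i] ⁻¹' A)ᶜ := by
    ext x; simp [avoid]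
  rw [this]
  exact Finset.measurableSet_biInter _ fun i _ => ((hf.iterate i) hA).compl

variable {μ : Measure M}

lemma measureReal_preimage_iterate (hf : MeasurePreserving f μ μ) (hA : MeasurableSet A) (i : ℕ) :
    μ.real (f^[i] ⁻¹' A) = μ.real A := by
  rw [measureReal_def, (hf.iterate i).measure_preimage hA.nullMeasurableSet]
  rfl

lemma measureReal_avoid (hf : MeasurePreserving f μ μ) (hA : MeasurableSet A) (s ℓ : ℕ) :
    μ.real (avoid f A s ℓ) = μ.real (avoid f A 0 ℓ) := by
  have := preimage_iterate_avoid (f := f) (A := A) s 0 ℓ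
  rw [zero_add] at this
  rw [← this, measureReal_preimage_iterate hf (measurableSet_avoid hf.measurable hA 0 ℓ)]

lemma measureReal_biUnion_preimage_iterate_le (hf : MeasurePreserving f μ μ)
    (hA : MeasurableSet A) (s m : ℕ) :
    μ.real (⋃ i ∈ Finset.Ico s (s + m), f^[i] ⁻¹' A) ≤ m * μ.real A := by
  refine (measureReal_biUnion_finset_le _ _).trans ?_
  simp [measureReal_preimage_iterate hf hA]

variable [IsProbabilityMeasure μ]

/-- Lengthening the window by `m` loses at most `m * μ A`. -/
lemma measureReal_avoid_le_add (hf : MeasurePreserving f μ μ) (hA : MeasurableSet A) (ℓ m : ℕ) :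
    μ.real (avoid f A 0 ℓ) ≤ μ.real (avoid f A 0 (ℓ + m)) + m * μ.real A := by
  have hsub : avoid f A 0 ℓ ⊆
      avoid f A 0 (ℓ + m) ∪ ⋃ i ∈ Finset.Ico ℓ (ℓ + m), f^[i] ⁻¹' A := by
    intro x hx
    by_cases h : x ∈ ⋃ i ∈ Finset.Ico ℓ (ℓ + m), f^[i] ⁻¹' A
    · exact Or.inr h
    left
    simp only [Finset.mem_Ico, mem_iUnion, mem_preimage, not_exists] at h
    intro i h1 h2
    by_cases hi : i < ℓ
    · exact hx i h1 (by omega)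
    · exact h i ⟨by omega, by omega⟩
  linarith [measureReal_mono (μ := μ) hsub, measureReal_union_le (μ := μ) (avoid f A 0 (ℓ + m))
    (⋃ i ∈ Finset.Ico ℓ (ℓ + m), f^[i] ⁻¹' A),
    measureReal_biUnion_preimage_iterate_le hf hA ℓ m]

/-- Opening a block of length `b`, separated by a gap, in front of a window of length `ℓ`. -/
lemma abs_measureReal_avoid_inter_avoid_sub_le (hf : MeasurePreserving f μ μ)
    (hA : MeasurableSet A) {γ S : ℝ} {T ℓ B : ℕ}
    (hmix : ∀ t, T ≤ t → |μ.real (A ∩ avoid f A t ℓ) - μ.real A * μ.real (avoid f A 0 ℓ)| ≤ γ)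
    (hS : ∑ j ∈ Finset.Icc 1 B, μ.real (A ∩ f^[j] ⁻¹' A) ≤ S) (b : ℕ) (hb : b ≤ B) :
    |μ.real (avoid f A 0 b ∩ avoid f A (b + T) ℓ)
      - (1 - b * μ.real A) * μ.real (avoid f A 0 ℓ)| ≤ b * (γ + S) := by
  induction b with
  | zero => simp [avoid_zero_length, measureReal_avoid hf hA]
  | succ b ih =>
    have ih := ih (by omega)
    have hm := measurableSet_avoid (f := f) hf.measurable hA
    set R := avoid f A 0 b ∩ avoid f A (b + T) ℓ with hR
    have hRm : MeasurableSet R := (hm _ _).inter (hm _ _)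
    have hpre : f ⁻¹' R = avoid f A 1 b ∩ avoid f A (b + 1 + T) ℓ := by
      rw [hR, preimage_inter]
      have h1 := preimage_iterate_avoid (f := f) (A := A) 1 0 b
      have h2 := preimage_iterate_avoid (f := f) (A := A) 1 (b + T) ℓ
      rw [Function.iterate_one] at h1 h2
      rw [h1, h2, zero_add, show b + T + 1 = b + 1 + T by omega]
    -- Prepending one time to the block removes `A ∩ f⁻¹R`. Its measure is within `S` of that of `A`
    -- followed by the far window alone, which mixing replaces by a product up to `γ`.
    have hsplit : avoid f A 0 (b + 1) ∩ avoid f A (b + 1 + T) ℓ = f ⁻¹' R \ A := by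
      rw [hpre]
      ext x
      simp only [avoid, mem_inter_iff, mem_ofPred_eq, Set.mem_sdiff]
      constructor
      · rintro ⟨h1, h2⟩
        exact ⟨⟨fun i hi hi' => h1 i (by omega) (by omega), h2⟩, h1 0 le_rfl (by omega)⟩
      · rintro ⟨⟨h1, h2⟩, h0⟩
        refine ⟨fun i hi hi' => ?_, h2⟩
        rcases Nat.eq_zero_or_pos i with rfl | hi0
        · exact h0
        · exact h1 i hi0 (by omega)
    have hmeas : μ.real (f ⁻¹' R \ A) = μ.real R - μ.real (A ∩ f ⁻¹' R) := by
      have h1 := measureReal_inter_add_sdiff (μ := μ) (s := f ⁻¹' R) hA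
      have h2 : μ.real (f ⁻¹' R) = μ.real R := measureReal_preimage_iterate hf hRm 1
      rw [inter_comm]
      linarith
    have hupper : μ.real (A ∩ f ⁻¹' R) ≤ μ.real (A ∩ avoid f A (b + 1 + T) ℓ) := by
      refine measureReal_mono ?_
      rw [hpre]
      exact inter_subset_inter_right _ inter_subset_right
    have hlower : μ.real (A ∩ avoid f A (b + 1 + T) ℓ) ≤ μ.real (A ∩ f ⁻¹' R) + S := by
      have hsub : A ∩ avoid f A (b + 1 + T) ℓ ⊆
          (A ∩ f ⁻¹' R) ∪ ⋃ j ∈ Finset.Icc 1 B, (A ∩ f^[j] ⁻¹' A) := by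
        rintro x ⟨hxA, hx⟩
        by_cases h : x ∈ ⋃ j ∈ Finset.Icc 1 B, (A ∩ f^[j] ⁻¹' A)
        · exact Or.inr h
        left
        simp only [Finset.mem_Icc, mem_iUnion, mem_inter_iff, mem_preimage, not_exists,
          not_and] at h
        rw [hpre]
        exact ⟨hxA, fun i h1 h2 => h i ⟨h1, by omega⟩ hxA, hx⟩
      linarith [measureReal_mono (μ := μ) hsub, measureReal_union_le (μ := μ) (A ∩ f ⁻¹' R)
        (⋃ j ∈ Finset.Icc 1 B, (A ∩ f^[j] ⁻¹' A)), measureReal_biUnion_finset_le (μ := μ)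
        (Finset.Icc 1 B) (fun j => A ∩ f^[j] ⁻¹' A)]
    have hγ := abs_le.1 (hmix (b + 1 + T) (by omega))
    have hS0 : 0 ≤ S := (Finset.sum_nonneg fun _ _ => measureReal_nonneg).trans hS
    rw [hsplit, hmeas]
    rw [abs_le] at ih ⊢
    push_cast
    constructor <;> nlinarith

/-- Closing the gap again costs at most one visit to `A` at one of its `T` times. -/
lemma abs_measureReal_avoid_sub_le (hf : MeasurePreserving f μ μ)
    (hA : MeasurableSet A) {γ S : ℝ} {T ℓ b : ℕ}
    (hmix : ∀ t, T ≤ t → |μ.real (A ∩ avoid f A t ℓ) - μ.real A * μ.real (avoid f A 0 ℓ)| ≤ γ)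
    (hS : ∑ j ∈ Finset.Icc 1 b, μ.real (A ∩ f^[j] ⁻¹' A) ≤ S) :
    |μ.real (avoid f A 0 (b + T + ℓ)) - (1 - b * μ.real A) * μ.real (avoid f A 0 ℓ)|
      ≤ T * μ.real A + b * (γ + S) := by
  have h1 := abs_le.1 (abs_measureReal_avoid_inter_avoid_sub_le hf hA hmix hS b le_rfl)
  have hupper : μ.real (avoid f A 0 (b + T + ℓ))
      ≤ μ.real (avoid f A 0 b ∩ avoid f A (b + T) ℓ) := by
    refine measureReal_mono fun x hx => ⟨fun i _ hi => hx i (by omega) (by omega),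
      fun i _ hi => hx i (by omega) (by omega)⟩
  have hlower : μ.real (avoid f A 0 b ∩ avoid f A (b + T) ℓ)
      ≤ μ.real (avoid f A 0 (b + T + ℓ)) + T * μ.real A := by
    have hsub : avoid f A 0 b ∩ avoid f A (b + T) ℓ ⊆
        avoid f A 0 (b + T + ℓ) ∪ ⋃ i ∈ Finset.Ico b (b + T), f^[i] ⁻¹' A := by
      rintro x ⟨hx1, hx2⟩
      by_cases h : x ∈ ⋃ i ∈ Finset.Ico b (b + T), f^[i] ⁻¹' A
      · exact Or.inr h
      left
      simp only [Finset.mem_Ico, mem_iUnion, mem_preimage, not_exists] at h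
      intro i _ hi
      by_cases hi1 : i < b
      · exact hx1 i (by omega) (by omega)
      by_cases hi2 : i < b + T
      · exact h i ⟨by omega, hi2⟩
      · exact hx2 i (by omega) (by omega)
    linarith [measureReal_mono (μ := μ) hsub, measureReal_union_le (μ := μ)
      (avoid f A 0 (b + T + ℓ)) (⋃ i ∈ Finset.Ico b (b + T), f^[i] ⁻¹' A),
      measureReal_biUnion_preimage_iterate_le hf hA b T]
  have h0 : 0 ≤ (T : ℝ) * μ.real A := by positivity
  rw [abs_le]
  constructor <;> linarith

/-- Blocks are peeled off one at a time. The assumption `hb` keeps the factor in `[0, 1]`, so that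
errors add up without being amplified. -/
lemma abs_measureReal_avoid_sub_pow_le (hf : MeasurePreserving f μ μ)
    (hA : MeasurableSet A) {γ S : ℝ} {T b : ℕ}
    (hmix : ∀ t ℓ, T ≤ t →
      |μ.real (A ∩ avoid f A t ℓ) - μ.real A * μ.real (avoid f A 0 ℓ)| ≤ γ)
    (hS : ∑ j ∈ Finset.Icc 1 b, μ.real (A ∩ f^[j] ⁻¹' A) ≤ S) (hb : b * μ.real A ≤ 1) (m : ℕ) :
    |μ.real (avoid f A 0 (m * (b + T))) - (1 - b * μ.real A) ^ m|
      ≤ m * (T * μ.real A + b * (γ + S)) := by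
  induction m with
  | zero => simp [avoid_zero_length]
  | succ m ih =>
    have h1 := abs_le.1 (abs_measureReal_avoid_sub_le (ℓ := m * (b + T)) hf hA
      (fun t ht => hmix t _ ht) hS)
    rw [show (m + 1) * (b + T) = b + T + m * (b + T) by ring]
    have hx0 : 0 ≤ 1 - b * μ.real A := by linarith
    have hx1 : 1 - b * μ.real A ≤ 1 := by
      have : 0 ≤ b * μ.real A := by positivity
      linarith
    have h2 : |(1 - b * μ.real A) * (μ.real (avoid f A 0 (m * (b + T)))
        - (1 - b * μ.real A) ^ m)| ≤ m * (T * μ.real A + b * (γ + S)) := by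
      rw [abs_mul, abs_of_nonneg hx0]
      exact (mul_le_of_le_one_left (abs_nonneg _) hx1).trans ih
    have h2 := abs_le.1 h2
    rw [abs_le]
    push_cast
    rw [pow_succ]
    constructor <;> nlinarith

end Avoid

/-! ### The exponential law for escapes -/

lemma tendsto_one_sub_pow_exp {ι : Type*} {l : Filter ι} {x : ι → ℝ} {m : ι → ℕ} {c : ℝ}
    (hx : Tendsto x l (𝓝 0)) (hmx : Tendsto (fun i => (m i : ℝ) * x i) l (𝓝 c)) :
    Tendsto (fun i => (1 - x i) ^ m i) l (𝓝 (Real.exp (-c))) := by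
  have hup : Tendsto (fun i => Real.exp (-((m i : ℝ) * x i))) l (𝓝 (Real.exp (-c))) :=
    (Real.continuous_exp.tendsto _).comp hmx.neg
  have hlo : Tendsto (fun i => Real.exp (-((m i : ℝ) * x i / (1 - x i)))) l
      (𝓝 (Real.exp (-c))) := by
    have h1 : Tendsto (fun i => 1 - x i) l (𝓝 1) := by simpa using hx.const_sub 1
    have h2 := (hmx.div h1 one_ne_zero).neg
    rw [div_one] at h2
    exact (Real.continuous_exp.tendsto _).comp h2
  refine tendsto_of_tendsto_of_tendsto_of_le_of_le' hlo hup ?_ ?_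
  · filter_upwards [hx.eventually_lt_const (zero_lt_one (α := ℝ))] with i hi
    have hpos : 0 < 1 - x i := by linarith
    -- This is `1 - 1 / y ≤ log y` at `y = 1 - x`.
    have h1 : Real.exp (-(x i / (1 - x i))) ≤ 1 - x i := by
      have h2 := Real.one_sub_inv_le_log_of_pos hpos
      rw [← Real.le_log_iff_exp_le hpos]
      refine le_trans (le_of_eq ?_) h2
      field_simp
      ring
    calc Real.exp (-((m i : ℝ) * x i / (1 - x i)))
        = Real.exp (-(x i / (1 - x i))) ^ m i := by rw [← Real.exp_nat_mul]; ring_nf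
      _ ≤ _ := by gcongr
  · filter_upwards [hx.eventually_lt_const (zero_lt_one (α := ℝ))] with i hi
    have hpos : 0 ≤ 1 - x i := by linarith
    calc (1 - x i) ^ m i ≤ Real.exp (-(x i)) ^ m i := by
          gcongr
          linarith [Real.add_one_le_exp (-(x i))]
      _ = _ := by rw [← Real.exp_nat_mul]; ring_nf

section Poisson

variable {M : Type*} [MeasurableSpace M] {μ : Measure M} [IsProbabilityMeasure μ] {f : M → M}

/-- The block argument: under a mixing condition with gaps `T` and a no-clustering condition for
blocks of length `n / k`, avoiding `Q` has asymptotically exponential law. -/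
lemma tendsto_measureReal_avoid_exp (hf : MeasurePreserving f μ μ) {ι : Type*} {l : Filter ι}
    {Q : ι → Set M} {n k T N : ι → ℕ} {γ : ι → ℝ} {κ s : ℝ}
    (hQ : ∀ᶠ i in l, MeasurableSet (Q i))
    (hmix : ∀ᶠ i in l, ∀ t ℓ, T i ≤ t →
      |μ.real (Q i ∩ avoid f (Q i) t ℓ) - μ.real (Q i) * μ.real (avoid f (Q i) 0 ℓ)| ≤ γ i)
    (hn : Tendsto n l atTop) (hk : Tendsto k l atTop) (hT : ∀ᶠ i in l, 1 ≤ T i)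
    (hκ : Tendsto (fun i => (n i : ℝ) * μ.real (Q i)) l (𝓝 κ))
    (hγ : Tendsto (fun i => (n i : ℝ) * γ i) l (𝓝 0))
    (hkT : Tendsto (fun i => (k i : ℝ) * T i / n i) l (𝓝 0))
    (hS : Tendsto (fun i => (n i : ℝ) * ∑ j ∈ Finset.Icc 1 (n i / k i),
      μ.real (Q i ∩ f^[j] ⁻¹' Q i)) l (𝓝 0))
    (hN : Tendsto (fun i => (N i : ℝ) / n i) l (𝓝 s)) :
    Tendsto (fun i => μ.real (avoid f (Q i) 0 (N i))) l (𝓝 (Real.exp (-(s * κ)))) := by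
  set q : ι → ℝ := fun i => μ.real (Q i) with hq
  set S : ι → ℝ := fun i => ∑ j ∈ Finset.Icc 1 (n i / k i), μ.real (Q i ∩ f^[j] ⁻¹' Q i) with hSdef
  set b : ι → ℕ := fun i => n i / k i with hb
  set m : ι → ℕ := fun i => N i / (b i + T i) with hm
  have hn1 : ∀ᶠ i in l, 1 ≤ n i := hn.eventually_ge_atTop 1
  have hk1 : ∀ᶠ i in l, 1 ≤ k i := hk.eventually_ge_atTop 1
  -- sizes of blocks and gaps
  have hbn : Tendsto (fun i => (b i : ℝ) / n i) l (𝓝 0) := by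
    have hinv : Tendsto (fun i => ((k i : ℝ))⁻¹) l (𝓝 0) :=
      tendsto_inv_atTop_zero.comp (tendsto_natCast_atTop_atTop.comp hk)
    refine squeeze_zero' (.of_forall fun i => by positivity) ?_ hinv
    filter_upwards [hn1] with i hi
    have hi' : (0 : ℝ) < n i := by exact_mod_cast hi
    have h1 : (b i : ℝ) ≤ (n i : ℝ) / k i := Nat.cast_div_le
    rw [div_le_iff₀ hi']
    calc (b i : ℝ) ≤ (n i : ℝ) / k i := h1
      _ = _ := by ring
  have hTn : Tendsto (fun i => (T i : ℝ) / n i) l (𝓝 0) := by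
    refine squeeze_zero' (.of_forall fun i => by positivity) ?_ hkT
    filter_upwards [hk1] with i hi
    have hi' : (1 : ℝ) ≤ k i := by exact_mod_cast hi
    gcongr
    exact le_mul_of_one_le_left (Nat.cast_nonneg _) hi'
  -- Gaps are negligible against blocks. As `T ≥ 1`, eventually `2 k < n`, so rounding costs at most
  -- half of the block: `b ≥ n / (2 k)`. For zero gaps `k` could exceed `n` and `b` could vanish.
  have hTb : Tendsto (fun i => (T i : ℝ) / b i) l (𝓝 0) := by
    have h2 : Tendsto (fun i => 2 * ((k i : ℝ) * T i / n i)) l (𝓝 0) := by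
      simpa using hkT.const_mul 2
    refine squeeze_zero' (.of_forall fun i => by positivity) ?_ h2
    filter_upwards [hn1, hk1, hT, hkT.eventually_lt_const (by norm_num : (0 : ℝ) < 1 / 2)]
      with i hi1 hi2 hi3 hi4
    have hn0 : (0 : ℝ) < n i := by exact_mod_cast hi1
    have hk0 : (0 : ℝ) < k i := by exact_mod_cast hi2
    have hT0 : (1 : ℝ) ≤ T i := by exact_mod_cast hi3
    rw [div_lt_iff₀ hn0] at hi4
    have h2k : 2 * (k i : ℝ) < n i := by nlinarith
    have hlt : (n i : ℝ) < k i * (b i + 1) := by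
      exact_mod_cast Nat.lt_mul_div_succ (n i) hi2
    have hbk : (n i : ℝ) ≤ 2 * (k i * b i) := by nlinarith
    have hb0 : (0 : ℝ) < b i := by
      by_contra hcon
      have : (b i : ℝ) ≤ 0 := not_lt.1 hcon
      nlinarith
    rw [← mul_div_assoc, div_le_div_iff₀ hb0 hn0]
    nlinarith
  -- number of blocks
  have hblk : Tendsto (fun i => ((b i : ℝ) + T i) / n i) l (𝓝 0) := by
    simpa [add_div] using hbn.add hTn
  have hmblk_le : ∀ i, (m i : ℝ) * (b i + T i) ≤ N i := fun i => by
    exact_mod_cast Nat.div_mul_le_self (N i) (b i + T i)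
  have hmblk_ge : ∀ᶠ i in l, (N i : ℝ) ≤ m i * (b i + T i) + (b i + T i) := by
    filter_upwards [hT] with i hi
    have h := Nat.lt_mul_div_succ (N i) (show 0 < b i + T i by omega)
    have h' : N i ≤ m i * (b i + T i) + (b i + T i) := by
      calc N i ≤ (b i + T i) * (N i / (b i + T i) + 1) := h.le
        _ = _ := by simp only [hm]; ring
    exact_mod_cast h'
  have hmblk : Tendsto (fun i => (m i : ℝ) * (b i + T i) / n i) l (𝓝 s) := by
    have hlo : Tendsto (fun i => (N i : ℝ) / n i - ((b i : ℝ) + T i) / n i) l (𝓝 s) := by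
      simpa using hN.sub hblk
    refine tendsto_of_tendsto_of_tendsto_of_le_of_le' hlo hN ?_ ?_
    · filter_upwards [hmblk_ge] with i hi
      rw [← sub_div]
      gcongr
      linarith
    · refine .of_forall fun i => ?_
      gcongr
      exact hmblk_le i
  have hmT : Tendsto (fun i => (m i : ℝ) * T i / n i) l (𝓝 0) := by
    have h := hmblk.mul hTb
    rw [mul_zero] at h
    refine squeeze_zero' (.of_forall fun i => by positivity) ?_ h
    filter_upwards [hn1, hT, hk1, hkT.eventually_lt_const (zero_lt_one (α := ℝ))]
      with i hi1 hi2 hi3 hi4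
    have hn0 : (0 : ℝ) < n i := by exact_mod_cast hi1
    have hb0 : 0 < b i := by
      refine Nat.div_pos ?_ hi3
      rw [div_lt_one hn0] at hi4
      have hT1 : (1 : ℝ) ≤ T i := by exact_mod_cast hi2
      have hk0 : (0 : ℝ) ≤ k i := Nat.cast_nonneg _
      have : (k i : ℝ) ≤ n i := by nlinarith
      exact_mod_cast this
    have hb0' : (0 : ℝ) < b i := by exact_mod_cast hb0
    have : (m i : ℝ) * T i / n i = (m i * b i / n i) * (T i / b i) := by field_simp
    rw [this]
    gcongr
    exact le_add_of_nonneg_right (Nat.cast_nonneg _)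
  have hmb : Tendsto (fun i => (m i : ℝ) * b i / n i) l (𝓝 s) := by
    have h := hmblk.sub hmT
    rw [sub_zero] at h
    refine h.congr fun i => ?_
    rw [← sub_div]
    ring
  -- quantities scaled by `n`
  have hscale : ∀ {u v : ι → ℝ} {c e : ℝ}, Tendsto (fun i => u i / n i) l (𝓝 c) →
      Tendsto (fun i => (n i : ℝ) * v i) l (𝓝 e) → Tendsto (fun i => u i * v i) l (𝓝 (c * e)) := by
    intro u v c e hu hv
    refine (hu.mul hv).congr' ?_
    filter_upwards [hn1] with i hi
    have hn0 : (0 : ℝ) < n i := by exact_mod_cast hi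
    field_simp
  have hbq : Tendsto (fun i => (b i : ℝ) * q i) l (𝓝 0) := by
    simpa using hscale hbn hκ
  have hpow : Tendsto (fun i => (1 - (b i : ℝ) * q i) ^ m i) l (𝓝 (Real.exp (-(s * κ)))) := by
    refine tendsto_one_sub_pow_exp hbq ?_
    simpa [mul_assoc] using hscale hmb hκ
  -- Here `m b / n → s` while `m T / n → 0`, and `n q` is bounded while `n γ` and `n S` vanish.
  have herr : Tendsto (fun i => (m i : ℝ) * (T i * q i + b i * (γ i + S i))) l (𝓝 0) := by
    have h1 := hscale hmT hκ
    have h2 := hscale hmb hγ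
    have h3 := hscale hmb hS
    have h := h1.add (h2.add h3)
    simp only [zero_mul, mul_zero, add_zero] at h
    refine h.congr fun i => ?_
    ring
  have hmain : Tendsto (fun i => μ.real (avoid f (Q i) 0 (m i * (b i + T i)))) l
      (𝓝 (Real.exp (-(s * κ)))) := by
    have hdiff : Tendsto (fun i => μ.real (avoid f (Q i) 0 (m i * (b i + T i)))
        - (1 - (b i : ℝ) * q i) ^ m i) l (𝓝 0) := by
      refine squeeze_zero_norm' ?_ herr
      filter_upwards [hQ, hmix, hbq.eventually_lt_const (zero_lt_one (α := ℝ))] with i h1 h2 h3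
      exact abs_measureReal_avoid_sub_pow_le hf h1 h2 le_rfl h3.le (m i)
    simpa using hdiff.add hpow
  have hrem : Tendsto (fun i => ((b i : ℝ) + T i) * q i) l (𝓝 0) := by
    simpa using hscale hblk hκ
  have hlo : Tendsto (fun i => μ.real (avoid f (Q i) 0 (m i * (b i + T i)))
      - ((b i : ℝ) + T i) * q i) l (𝓝 (Real.exp (-(s * κ)))) := by
    simpa using hmain.sub hrem
  refine tendsto_of_tendsto_of_tendsto_of_le_of_le' hlo hmain ?_ ?_
  · filter_upwards [hQ, hT] with i h1 h2
    have h3 := measureReal_avoid_le_add hf h1 (m i * (b i + T i)) (b i + T i)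
    have hle : N i ≤ m i * (b i + T i) + (b i + T i) := by
      have h := Nat.lt_mul_div_succ (N i) (show 0 < b i + T i by omega)
      calc N i ≤ (b i + T i) * (N i / (b i + T i) + 1) := h.le
        _ = _ := by simp only [hm]; ring
    have h4 := measureReal_mono (μ := μ) (avoid_antitone (f := f) (A := Q i) 0 hle)
    push_cast at h3
    linarith
  · exact .of_forall fun i => measureReal_mono (avoid_antitone 0 (Nat.div_mul_le_self _ _))

/-- Never escaping from `B` through `f^[p]` and never entering `B` differ, up to time `N`, only by
the visits to `B` at the times `N, …, N + p - 1`. -/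
lemma abs_measureReal_avoid_sub_avoid_escape_le (hf : MeasurePreserving f μ μ) {B : Set M}
    (hB : MeasurableSet B) {p : ℕ} (hp : 0 < p) (N : ℕ) :
    |μ.real (avoid f B 0 N) - μ.real (avoid f (B \ f^[p] ⁻¹' B) 0 N)| ≤ p * μ.real B := by
  have h1 : avoid f B 0 N ⊆ avoid f (B \ f^[p] ⁻¹' B) 0 N := fun x hx i hi hi' h =>
    hx i hi hi' h.1
  have h2 : avoid f (B \ f^[p] ⁻¹' B) 0 N ⊆
      avoid f B 0 N ∪ ⋃ i ∈ Finset.Ico N (N + p), f^[i] ⁻¹' B := by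
    intro x hx
    by_cases h : x ∈ avoid f B 0 N
    · exact Or.inl h
    right
    simp only [avoid, mem_ofPred_eq, not_forall, not_not] at h
    obtain ⟨i, -, hiN, hi⟩ := h
    -- Without an escape before `N`, a visit to `B` at a time before `N` repeats `p` steps later.
    have hchain : ∀ r : ℕ, i + r * p < N + p → f^[i + r * p] x ∈ B := by
      intro r
      induction r with
      | zero => intro _; simpa using hi
      | succ r ih =>
        intro hr
        have hr' : i + r * p < N := by
          rw [Nat.succ_mul] at hr
          omega
        have h3 := ih (by omega)
        have h4 := hx (i + r * p) (Nat.zero_le _) (by omega)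
        have h5 : f^[p] (f^[i + r * p] x) ∈ B := by
          by_contra hcon
          exact h4 ⟨h3, hcon⟩
        rw [← Function.iterate_add_apply] at h5
        rwa [show i + (r + 1) * p = p + (i + r * p) by ring]
    have hex : ∃ r : ℕ, N ≤ i + r * p ∧ i + r * p < N + p := by
      -- The ceiling of `(N - i) / p`: the first time of the progression that reaches `N`.
      refine ⟨(N - i + p - 1) / p, ?_, ?_⟩
      · have := Nat.lt_div_mul_add (a := N - i + p - 1) hp
        omega
      · have := Nat.div_mul_le_self (N - i + p - 1) p
        omega
    obtain ⟨r, hr1, hr2⟩ := hex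
    simp only [Finset.mem_Ico, mem_iUnion, mem_preimage]
    exact ⟨i + r * p, ⟨hr1, hr2⟩, hchain r hr2⟩
  have h3 := measureReal_mono (μ := μ) h1
  have h4 := measureReal_mono (μ := μ) h2
  have h5 := measureReal_union_le (μ := μ) (avoid f B 0 N)
    (⋃ i ∈ Finset.Ico N (N + p), f^[i] ⁻¹' B)
  have h6 := measureReal_biUnion_preimage_iterate_le hf hB N p
  rw [abs_le]
  constructor <;> linarith

/-- Comparison of the entrance laws of nested sets. -/
lemma abs_measureReal_avoid_sub_avoid_le (hf : MeasurePreserving f μ μ) {B B' : Set M}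
    (hB : MeasurableSet B) (hB' : MeasurableSet B') (h : B ⊆ B') (N : ℕ) :
    |μ.real (avoid f B 0 N) - μ.real (avoid f B' 0 N)| ≤ N * |μ.real B - μ.real B'| := by
  have h1 : avoid f B' 0 N ⊆ avoid f B 0 N := fun x hx i hi hi' hB => hx i hi hi' (h hB)
  have h2 : avoid f B 0 N ⊆ avoid f B' 0 N ∪ ⋃ i ∈ Finset.Ico 0 (0 + N), f^[i] ⁻¹' (B' \ B) := by
    intro x hx
    by_cases hx' : x ∈ avoid f B' 0 N
    · exact Or.inl hx'
    right
    simp only [avoid, mem_ofPred_eq, not_forall, not_not] at hx'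
    obtain ⟨i, h0, hiN, hi⟩ := hx'
    simp only [Finset.mem_Ico, mem_iUnion, mem_preimage]
    exact ⟨i, ⟨h0, hiN⟩, hi, hx i h0 hiN⟩
  have h3 := measureReal_mono (μ := μ) h1
  have h4 := measureReal_mono (μ := μ) h2
  have h5 := measureReal_union_le (μ := μ) (avoid f B' 0 N)
    (⋃ i ∈ Finset.Ico 0 (0 + N), f^[i] ⁻¹' (B' \ B))
  have h6 := measureReal_biUnion_preimage_iterate_le hf (hB'.diff hB) 0 N
  have h7 : μ.real (B' \ B) = μ.real B' - μ.real B := measureReal_sdiff h hB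
  have h8 := measureReal_mono (μ := μ) h
  rw [abs_sub_comm (μ.real B), abs_of_nonneg (by linarith : 0 ≤ μ.real B' - μ.real B), ← h7,
    abs_of_nonneg (by linarith)]
  linarith

end Poisson

/-! ### Hitting and return times -/

section HittingTime

variable {M : Type*} {f : M → M} {A : Set M}

lemma hittingTime_le_natCast_iff (x : M) (K : ℕ) :
    hittingTime f A x ≤ (K : ℕ∞) ↔ ∃ j, 1 ≤ j ∧ j ≤ K ∧ f^[j] x ∈ A := by
  constructor
  · intro h
    by_contra! hcon
    have hle : ((K + 1 : ℕ) : ℕ∞) ≤ hittingTime f A x := by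
      refine le_iInf fun j => ?_
      have : K < (j : ℕ) := by
        by_contra hj
        exact hcon j j.2.1 (by omega) j.2.2
      exact_mod_cast this
    have := hle.trans h
    norm_cast at this
    omega
  · rintro ⟨j, h1, h2, h3⟩
    exact (iInf_le (fun j : {j : ℕ // 1 ≤ j ∧ f^[j] x ∈ A} => ((j : ℕ) : ℕ∞)) ⟨j, h1, h3⟩).trans
      (by exact_mod_cast h2)

lemma enat_coe_le_ofReal_iff (h : ℕ∞) {y : ℝ} (hy : 0 ≤ y) :
    ((h : ℕ∞) : ℝ≥0∞) ≤ ENNReal.ofReal y ↔ h ≤ (⌊y⌋₊ : ℕ∞) := by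
  induction h using ENat.recTopCoe with
  | top => simp
  | coe k =>
    rw [Nat.cast_le, Nat.le_floor_iff hy, ENat.toENNReal_coe, ENNReal.le_ofReal_iff_toReal_le
      (by simp) hy, ENNReal.toReal_natCast]

variable [MeasurableSpace M] {μ : Measure M}

lemma hitLT_subset_hitLE (t : ℝ) : hitLT μ f A t ⊆ hitLE μ f A t := fun x hx =>
  le_of_lt (show (hittingTime f A x : ℝ≥0∞) < ENNReal.ofReal t / μ A from hx)

lemma hitLT_zero : hitLT μ f A 0 = ∅ := by
  ext x
  simp [hitLT]

variable [IsProbabilityMeasure μ]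

/-- The window starts at time `1`, since the starting point itself does not count as a hit. -/
lemma hitLE_eq_compl_avoid (hA : 0 < μ.real A) {t : ℝ} (ht : 0 ≤ t) :
    hitLE μ f A t = (avoid f A 1 ⌊t / μ.real A⌋₊)ᶜ := by
  ext x
  have hquot : ENNReal.ofReal t / μ A = ENNReal.ofReal (t / μ.real A) := by
    rw [ENNReal.ofReal_div_of_pos hA, ofReal_measureReal]
  simp only [hitLE, mem_ofPred_eq, mem_compl_iff, avoid, hquot]
  rw [enat_coe_le_ofReal_iff _ (by positivity), hittingTime_le_natCast_iff]
  push Not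
  exact exists_congr fun j => and_congr_right fun _ => and_congr_left fun _ => by omega

lemma hitLE_subset_hitLT (hA : 0 < μ.real A) {s t : ℝ} (hs : 0 ≤ s) (hst : s < t) :
    hitLE μ f A s ⊆ hitLT μ f A t := by
  intro x hx
  have h1 : ∀ r, ENNReal.ofReal r / μ A = ENNReal.ofReal (r / μ.real A) := fun r => by
    rw [ENNReal.ofReal_div_of_pos hA, ofReal_measureReal]
  refine lt_of_le_of_lt
    (show (hittingTime f A x : ℝ≥0∞) ≤ ENNReal.ofReal s / μ A from hx) ?_
  rw [h1, h1]
  have : s / μ.real A < t / μ.real A := by gcongr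
  exact (ENNReal.ofReal_lt_ofReal_iff_of_nonneg (by positivity)).2 this

lemma measureReal_hitLE (hf : MeasurePreserving f μ μ) (hAm : MeasurableSet A)
    (hA : 0 < μ.real A) {t : ℝ} (ht : 0 ≤ t) :
    μ.real (hitLE μ f A t) = 1 - μ.real (avoid f A 0 ⌊t / μ.real A⌋₊) := by
  rw [hitLE_eq_compl_avoid hA ht, probReal_compl_eq_one_sub
    (measurableSet_avoid hf.measurable hAm _ _), measureReal_avoid hf hAm]

/-- Split the avoidance of `A` during `1, …, K` by whether time `0` is in `A`. By invariance, return
probabilities are increments of the avoidance probability. -/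
lemma measureReal_inter_avoid_one (hf : MeasurePreserving f μ μ) (hAm : MeasurableSet A)
    (K : ℕ) :
    μ.real (A ∩ avoid f A 1 K) = μ.real (avoid f A 0 K) - μ.real (avoid f A 0 (K + 1)) := by
  have h1 := measureReal_inter_add_sdiff (μ := μ) (s := avoid f A 1 K) hAm
  have h2 : avoid f A 1 K \ A = avoid f A 0 (K + 1) := by
    ext x
    simp only [avoid, Set.mem_sdiff, mem_ofPred_eq]
    constructor
    · rintro ⟨h, h0⟩ i _ hi
      rcases Nat.eq_zero_or_pos i with rfl | hi0
      · exact h0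
      · exact h i hi0 (by omega)
    · intro h
      exact ⟨fun i _ hi => h i (by omega) (by omega), h 0 le_rfl (by omega)⟩
  rw [h2, measureReal_avoid hf hAm 1, inter_comm] at h1
  linarith

lemma cond_measureReal_hitLE (hf : MeasurePreserving f μ μ) (hAm : MeasurableSet A)
    (hA : 0 < μ.real A) {t : ℝ} (ht : 0 ≤ t) :
    (ProbabilityTheory.cond μ A).real (hitLE μ f A t)
      = 1 - μ.real (A ∩ avoid f A 1 ⌊t / μ.real A⌋₊) / μ.real A := by
  have : IsProbabilityMeasure (ProbabilityTheory.cond μ A) :=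
    ProbabilityTheory.cond_isProbabilityMeasure
      fun h => hA.ne' (by rw [measureReal_def, h, ENNReal.toReal_zero])
  rw [hitLE_eq_compl_avoid hA ht, probReal_compl_eq_one_sub
    (measurableSet_avoid hf.measurable hAm _ _), measureReal_def,
    ProbabilityTheory.cond_apply hAm, ENNReal.toReal_mul, ENNReal.toReal_inv, inv_mul_eq_div]
  rfl

/-- Discrete convexity: the increments are monotone in `K`, so a sum of `m` of them lies between `m`
times the last and `m` times the first. -/
lemma mul_measureReal_inter_avoid_le (hf : MeasurePreserving f μ μ) (hAm : MeasurableSet A)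
    (K m : ℕ) :
    m * μ.real (A ∩ avoid f A 1 (K + m))
        ≤ μ.real (avoid f A 0 K) - μ.real (avoid f A 0 (K + m)) ∧
      μ.real (avoid f A 0 K) - μ.real (avoid f A 0 (K + m)) ≤ m * μ.real (A ∩ avoid f A 1 K) := by
  have hanti : ∀ {i j : ℕ}, i ≤ j →
      μ.real (A ∩ avoid f A 1 j) ≤ μ.real (A ∩ avoid f A 1 i) := fun h =>
    measureReal_mono (inter_subset_inter_right _ (avoid_antitone 1 h))
  induction m with
  | zero => simp
  | succ m ih =>
    have h1 := measureReal_inter_avoid_one hf hAm (K + m)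
    have h2 := hanti (show K + m ≤ K + (m + 1) by omega)
    have h3 := hanti (show K ≤ K + m by omega)
    have h4 : (m : ℝ) * μ.real (A ∩ avoid f A 1 (K + (m + 1)))
        ≤ m * μ.real (A ∩ avoid f A 1 (K + m)) := by gcongr
    rw [show K + m + 1 = K + (m + 1) by omega] at h1
    push_cast
    constructor <;> nlinarith [ih.1, ih.2]

end HittingTime

section ReturnTimes

lemma tendsto_floor_div_mul {c : ℕ → ℝ} (hc : ∀ n, 0 < c n) (hc0 : Tendsto c atTop (𝓝 0))
    {t : ℝ} (ht : 0 ≤ t) : Tendsto (fun n => (⌊t / c n⌋₊ : ℝ) * c n) atTop (𝓝 t) := by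
  have hlo : Tendsto (fun n => t - c n) atTop (𝓝 t) := by simpa using hc0.const_sub t
  refine tendsto_of_tendsto_of_tendsto_of_le_of_le hlo tendsto_const_nhds (fun n => ?_)
    (fun n => ?_)
  · have h := Nat.lt_floor_add_one (t / c n)
    rw [div_lt_iff₀ (hc n)] at h
    change t - c n ≤ _
    linarith
  · have h := Nat.floor_le (div_nonneg ht (hc n).le)
    rwa [le_div_iff₀ (hc n)] at h

variable {M : Type*} [MeasurableSpace M] {μ : Measure M} [IsProbabilityMeasure μ] {f : M → M}
  {U : ℕ → Set M} {θ : ℝ}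

/-- Hitting times statistics determine return times statistics. -/
lemma tendsto_inter_avoid_div (hf : MeasurePreserving f μ μ) (hU : ∀ n, MeasurableSet (U n))
    (hpos : ∀ n, 0 < μ.real (U n)) (hU0 : Tendsto (fun n => μ.real (U n)) atTop (𝓝 0))
    (hexp : ∀ t : ℝ, 0 ≤ t → Tendsto
      (fun n => μ.real (avoid f (U n) 0 ⌊t / μ.real (U n)⌋₊)) atTop (𝓝 (Real.exp (-θ * t))))
    {t : ℝ} (ht : 0 < t) :
    Tendsto (fun n => μ.real (U n ∩ avoid f (U n) 1 ⌊t / μ.real (U n)⌋₊) / μ.real (U n)) atTop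
      (𝓝 (θ * Real.exp (-θ * t))) := by
  set c : ℕ → ℝ := fun n => μ.real (U n) with hc
  set K : ℝ → ℕ → ℕ := fun s n => ⌊s / c n⌋₊ with hK
  have hKmono : ∀ {s s' : ℝ} (n : ℕ), s ≤ s' → K s n ≤ K s' n := fun n h =>
    Nat.floor_mono (div_le_div_of_nonneg_right h (hpos n).le)
  have hgap : ∀ {s s' : ℝ}, 0 ≤ s → s < s' →
      Tendsto (fun n => ((K s' n - K s n : ℕ) : ℝ) * c n) atTop (𝓝 (s' - s)) := by
    intro s s' hs hss'
    refine ((tendsto_floor_div_mul hpos hU0 (hs.trans hss'.le)).sub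
      (tendsto_floor_div_mul hpos hU0 hs)).congr fun n => ?_
    rw [Nat.cast_sub (hKmono n hss'.le)]
    ring
  have hquot : ∀ {s s' : ℝ}, 0 ≤ s → s < s' → Tendsto (fun n =>
      (μ.real (avoid f (U n) 0 (K s n)) - μ.real (avoid f (U n) 0 (K s' n)))
        / (((K s' n - K s n : ℕ) : ℝ) * c n)) atTop
      (𝓝 ((Real.exp (-θ * s) - Real.exp (-θ * s')) / (s' - s))) := fun hs hss' =>
    ((hexp _ hs).sub (hexp _ (hs.trans hss'.le))).div (hgap hs hss') (by linarith)
  have hgappos : ∀ {s s' : ℝ}, 0 ≤ s → s < s' →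
      ∀ᶠ n in atTop, 0 < ((K s' n - K s n : ℕ) : ℝ) * c n := fun hs hss' =>
    (hgap hs hss').eventually_const_lt (by linarith)
  have hderiv : Tendsto (fun h : ℝ => h⁻¹ • (Real.exp (-θ * (t + h)) - Real.exp (-θ * t)))
      (𝓝[≠] 0) (𝓝 (-(θ * Real.exp (-θ * t)))) := by
    have h1 : HasDerivAt (fun s : ℝ => Real.exp (-θ * s)) (Real.exp (-θ * t) * (-θ * 1)) t :=
      ((hasDerivAt_id t).const_mul (-θ)).exp
    have h2 := hasDerivAt_iff_tendsto_slope_zero.1 h1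
    convert h2 using 2
    ring
  have hright : Tendsto (fun h : ℝ => (Real.exp (-θ * t) - Real.exp (-θ * (t + h)))
      / (t + h - t)) (𝓝[>] 0) (𝓝 (θ * Real.exp (-θ * t))) := by
    have h := (hderiv.mono_left (nhdsGT_le_nhdsNE 0)).neg
    rw [neg_neg] at h
    refine h.congr fun s => ?_
    rw [smul_eq_mul, add_sub_cancel_left, inv_mul_eq_div, ← neg_div, neg_sub]
  have hleft : Tendsto (fun h : ℝ => (Real.exp (-θ * (t - h)) - Real.exp (-θ * t))
      / (t - (t - h))) (𝓝[>] 0) (𝓝 (θ * Real.exp (-θ * t))) := by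
    have hneg : Tendsto (fun h : ℝ => -h) (𝓝[>] 0) (𝓝[≠] 0) := by
      refine tendsto_nhdsWithin_iff.2 ⟨?_, ?_⟩
      · simpa using (continuous_neg.tendsto (0 : ℝ)).mono_left nhdsWithin_le_nhds
      · filter_upwards [self_mem_nhdsWithin] with s hs
        have hs : 0 < s := hs
        simp [hs.ne']
    have h := (hderiv.comp hneg).neg
    rw [neg_neg] at h
    refine h.congr fun s => ?_
    simp only [Function.comp_apply, smul_eq_mul]
    rw [inv_neg, sub_sub_cancel, ← sub_eq_add_neg, neg_mul, neg_neg, inv_mul_eq_div]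
  -- By convexity the return probability lies between the right and left difference quotients, whose
  -- limits approach the derivative as the step shrinks. The left one needs `t > 0`.
  refine tendsto_order.2 ⟨fun b hb => ?_, fun b hb => ?_⟩
  · obtain ⟨h, hh, h0⟩ :=
      ((hright.eventually_const_lt hb).and self_mem_nhdsWithin).exists
    have h0 : 0 < h := h0
    have hlt : t < t + h := by linarith
    filter_upwards [(hquot ht.le hlt).eventually_const_lt hh, hgappos ht.le hlt] with n h1 h2
    have h3 := (mul_measureReal_inter_avoid_le hf (hU n) (K t n) (K (t + h) n - K t n)).2
    rw [Nat.add_sub_cancel' (hKmono n hlt.le)] at h3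
    refine h1.trans_le ?_
    rw [div_le_div_iff₀ h2 (hpos n)]
    have := mul_le_mul_of_nonneg_right h3 (hpos n).le
    linarith
  · obtain ⟨h, hh, h0⟩ :=
      ((hleft.eventually_lt_const hb).and (Ioo_mem_nhdsGT ht)).exists
    have hlt : t - h < t := by linarith [h0.1]
    have hnn : 0 ≤ t - h := by linarith [h0.2]
    filter_upwards [(hquot hnn hlt).eventually_lt_const hh, hgappos hnn hlt] with n h1 h2
    have h3 := (mul_measureReal_inter_avoid_le hf (hU n) (K (t - h) n) (K t n - K (t - h) n)).1
    rw [Nat.add_sub_cancel' (hKmono n hlt.le)] at h3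
    refine lt_of_le_of_lt ?_ h1
    rw [div_le_div_iff₀ (hpos n) h2]
    have := mul_le_mul_of_nonneg_right h3 (hpos n).le
    linarith

/-- Sandwich the strict event at `t` between the weak events at some `s < t` and at `t`; continuity
of `G` closes the gap. -/
lemma tendsto_hitLT_of_tendsto_hitLE {ν : ℕ → Measure M} [∀ n, IsFiniteMeasure (ν n)]
    (hpos : ∀ n, 0 < μ.real (U n)) {G : ℝ → ℝ} (hG : Continuous G)
    (hlim : ∀ t : ℝ, 0 < t → Tendsto (fun n => (ν n).real (hitLE μ f (U n) t)) atTop (𝓝 (G t)))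
    {t : ℝ} (ht : 0 < t) :
    Tendsto (fun n => (ν n).real (hitLT μ f (U n) t)) atTop (𝓝 (G t)) := by
  refine tendsto_order.2 ⟨fun b hb => ?_, fun b hb => ?_⟩
  · have hcont : Tendsto G (𝓝[<] t) (𝓝 (G t)) := (hG.tendsto t).mono_left nhdsWithin_le_nhds
    obtain ⟨s, hs, hs0⟩ := ((hcont.eventually_const_lt hb).and (Ioo_mem_nhdsLT ht)).exists
    filter_upwards [(hlim s hs0.1).eventually_const_lt hs] with n hn
    exact hn.trans_le (measureReal_mono (hitLE_subset_hitLT (hpos n) hs0.1.le hs0.2))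
  · filter_upwards [(hlim t ht).eventually_lt_const hb] with n hn
    exact (measureReal_mono (hitLT_subset_hitLE t)).trans_lt hn

/-- Hitting and return times statistics, with both kinds of inequalities, from the asymptotic
probability of avoiding the sets `U n`. -/
lemma hasHTS_and_hasRTS_of_tendsto_avoid (hf : MeasurePreserving f μ μ)
    (hU : ∀ n, MeasurableSet (U n)) (hpos : ∀ n, 0 < μ.real (U n))
    (hU0 : Tendsto (fun n => μ.real (U n)) atTop (𝓝 0))
    (hexp : ∀ t : ℝ, 0 ≤ t → Tendsto
      (fun n => μ.real (avoid f (U n) 0 ⌊t / μ.real (U n)⌋₊)) atTop (𝓝 (Real.exp (-θ * t)))) :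
    HasHTS μ f U (fun t => 1 - Real.exp (-θ * t)) ∧
    HasRTS μ f U (fun t => (1 - θ) + θ * (1 - Real.exp (-θ * t))) ∧
    (∀ t : ℝ, 0 ≤ t → Tendsto (fun n => μ.real (hitLT μ f (U n) t)) atTop
      (𝓝 (1 - Real.exp (-θ * t)))) ∧
    (∀ t : ℝ, 0 < t → Tendsto
      (fun n => (ProbabilityTheory.cond μ (U n)).real (hitLT μ f (U n) t)) atTop
      (𝓝 ((1 - θ) + θ * (1 - Real.exp (-θ * t))))) := by
  have hzero : Tendsto (fun n => μ (U n)) atTop (𝓝 0) := by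
    have := (ENNReal.continuous_ofReal.tendsto 0).comp hU0
    simpa [Function.comp_def, ofReal_measureReal] using this
  have hHTS : ∀ t : ℝ, 0 ≤ t → Tendsto (fun n => μ.real (hitLE μ f (U n) t)) atTop
      (𝓝 (1 - Real.exp (-θ * t))) := fun t ht =>
    ((hexp t ht).const_sub 1).congr fun n => (measureReal_hitLE hf (hU n) (hpos n) ht).symm
  have hRTS : ∀ t : ℝ, 0 < t → Tendsto
      (fun n => (ProbabilityTheory.cond μ (U n)).real (hitLE μ f (U n) t)) atTop
      (𝓝 ((1 - θ) + θ * (1 - Real.exp (-θ * t)))) := fun t ht => by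
    have h := (tendsto_inter_avoid_div hf hU hpos hU0 hexp ht).const_sub 1
    rw [show (1 - θ) + θ * (1 - Real.exp (-θ * t)) = 1 - θ * Real.exp (-θ * t) by ring]
    exact h.congr fun n => (cond_measureReal_hitLE hf (hU n) (hpos n) ht.le).symm
  refine ⟨⟨hzero, hHTS⟩, ⟨hzero, hRTS⟩, fun t ht => ?_, fun t ht => ?_⟩
  · rcases ht.eq_or_lt with rfl | ht
    · simp [hitLT_zero]
    · exact tendsto_hitLT_of_tendsto_hitLE (ν := fun _ => μ) hpos
        (G := fun t => 1 - Real.exp (-θ * t)) (by fun_prop) (fun t ht => hHTS t ht.le) ht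
  · exact tendsto_hitLT_of_tendsto_hitLE (ν := fun n => ProbabilityTheory.cond μ (U n)) hpos
      (G := fun t => (1 - θ) + θ * (1 - Real.exp (-θ * t))) (by fun_prop) hRTS ht

end ReturnTimes

/-! ### Exceedances as balls, and transfer to arbitrary radii -/

section Observable

variable {M : Type*} [Dist M] {f : M → M} {ζ : M} {g : ℝ → EReal}

lemma escape_process_eq_preimage (p i : ℕ) (u : ℝ) :
    escape (process f ζ g) p i u = f^[i] ⁻¹' escape (process f ζ g) p 0 u := by
  ext x
  simp only [escape, process, mem_preimage, mem_ofPred_eq, zero_add, Function.iterate_zero_apply,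
    ← Function.iterate_add_apply, add_comm p i]

lemma noEscape_process_eq_avoid (p s ℓ : ℕ) (u : ℝ) :
    noEscape (process f ζ g) p s ℓ u = avoid f (escape (process f ζ g) p 0 u) s ℓ := by
  ext x
  simp only [noEscape, avoid, mem_iInter, Finset.mem_Ico, mem_compl_iff, mem_ofPred_eq]
  refine forall_congr' fun i => ?_
  rw [escape_process_eq_preimage p i, mem_preimage]
  exact and_imp

lemma escape_process_zero_eq_diff (p : ℕ) (u : ℝ) :
    escape (process f ζ g) p 0 u = {x | (u : EReal) < process f ζ g 0 x} \
      f^[p] ⁻¹' {x | (u : EReal) < process f ζ g 0 x} := by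
  ext x
  simp only [escape, process, Set.mem_sdiff, mem_preimage, mem_ofPred_eq, zero_add,
    Function.iterate_zero_apply, not_lt]

end Observable

/-- Levels whose exceedances have vanishing but positive probability are eventually exceeded on
small balls. -/
lemma IsPeak.exists_radius {M : Type*} [MetricSpace M] [MeasurableSpace M] {μ : Measure M}
    [IsProbabilityMeasure μ] {f : M → M} {ζ : M} {g : ℝ → EReal} (hg : IsPeak g)
    (hball : ∀ r : ℝ, 0 < r → 0 < μ.real (Metric.ball ζ r)) {u : ℕ → ℝ} {τ : ℝ} (hτ : 0 < τ)
    (hu : Tendsto (fun n : ℕ => (n : ℝ) * μ.real {x | (u n : EReal) < process f ζ g 0 x})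
      atTop (𝓝 τ)) :
    ∃ r : ℕ → ℝ, Tendsto r atTop (𝓝[>] 0) ∧
      ∀ᶠ n in atTop, {x | (u n : EReal) < process f ζ g 0 x} = Metric.ball ζ (r n) := by
  obtain ⟨ε, hε, w, hw, hanti, hbij, hout⟩ := hg
  set V : ℕ → Set M := fun n => {x | (u n : EReal) < process f ζ g 0 x} with hV
  have hVmem : ∀ n x, x ∈ V n ↔ (u n : EReal) < g (dist x ζ) := fun n x => Iff.rfl
  have hV0 : Tendsto (fun n => μ.real (V n)) atTop (𝓝 0) := by
    have h := hu.mul (tendsto_inv_atTop_zero.comp (tendsto_natCast_atTop_atTop (R := ℝ)))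
    rw [mul_zero] at h
    refine h.congr' ?_
    filter_upwards [eventually_ge_atTop 1] with n hn
    have hn' : (0 : ℝ) < n := by exact_mod_cast hn
    simp only [Function.comp_apply, hV]
    field_simp
  -- A level at or below `w` is exceeded on all of `ball ζ ε`, whose measure is bounded away from
  -- the vanishing `μ (V n)`.
  have hwu : ∀ᶠ n in atTop, w < (u n : EReal) := by
    filter_upwards [hV0.eventually_lt_const (hball ε hε)] with n hn
    by_contra hcon
    refine absurd (measureReal_mono (μ := μ) (fun x hx => ?_)) (not_le.2 hn)
    exact (hVmem n x).2 ((not_lt.1 hcon).trans_lt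
      (hbij.mapsTo (show dist x ζ ∈ Ico 0 ε from ⟨dist_nonneg, hx⟩)).1)
  -- A level at or above the maximum is never exceeded, which contradicts `τ > 0`.
  have hug : ∀ᶠ n in atTop, (u n : EReal) < g 0 := by
    filter_upwards [hu.eventually_const_lt hτ] with n hn
    by_contra hcon
    have hempty : V n = ∅ := by
      refine eq_empty_of_forall_notMem fun x hx => ?_
      have h1 := ((not_lt.1 hcon).trans_lt ((hVmem n x).1 hx))
      rcases lt_or_ge (dist x ζ) ε with h | h
      · exact absurd (hbij.mapsTo (show dist x ζ ∈ Ico 0 ε from ⟨dist_nonneg, h⟩)).2 (not_le.2 h1)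
      · exact absurd ((hout _ h).trans hw.le) (not_le.2 h1)
    simp only [hV] at hempty
    simp [hempty] at hn
  have hr : ∀ᶠ n in atTop, ∃ r, 0 < r ∧ V n = Metric.ball ζ r := by
    filter_upwards [hwu, hug] with n h1 h2
    obtain ⟨r, hr, hgr⟩ := hbij.surjOn ⟨h1, h2.le⟩
    have hr0 : r ≠ 0 := by
      rintro rfl
      exact h2.ne hgr.symm
    refine ⟨r, lt_of_le_of_ne hr.1 hr0.symm, ?_⟩
    ext x
    rw [hVmem, Metric.mem_ball]
    rcases lt_or_ge (dist x ζ) ε with h | h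
    · rw [← hgr]
      exact hanti.lt_iff_gt hr ⟨dist_nonneg, h⟩
    · have h3 : ¬ dist x ζ < r := not_lt.2 (hr.2.le.trans h)
      have h4 : ¬ (u n : EReal) < g (dist x ζ) := not_lt.2 ((hout _ h).trans h1.le)
      exact iff_of_false h4 h3
  obtain ⟨r, hr⟩ : ∃ r : ℕ → ℝ, ∀ᶠ n in atTop, 0 < r n ∧ V n = Metric.ball ζ (r n) := by
    classical
    refine ⟨fun n => if h : ∃ r, 0 < r ∧ V n = Metric.ball ζ r then h.choose else 0, ?_⟩
    filter_upwards [hr] with n hn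
    simp only [hn, dif_pos]
    exact hn.choose_spec
  refine ⟨r, ?_, hr.mono fun n hn => hn.2⟩
  refine tendsto_nhdsWithin_iff.2 ⟨?_, hr.mono fun n hn => hn.1⟩
  refine tendsto_order.2 ⟨fun b hb => ?_, fun b hb => ?_⟩
  · filter_upwards [hr] with n hn using hb.trans hn.1
  · filter_upwards [hr, hV0.eventually_lt_const (hball b hb)] with n hn hn'
    by_contra hcon
    rw [hn.2] at hn'
    exact absurd (measureReal_mono (μ := μ) (Metric.ball_subset_ball (not_lt.1 hcon)))
      (not_le.2 hn')

/-- Transfer of the exponential law along levels `n` to arbitrary balls shrinking to `ζ`. -/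
lemma tendsto_measureReal_avoid_ball {M : Type*} [MetricSpace M] [MeasurableSpace M]
    [BorelSpace M] {μ : Measure M} [IsProbabilityMeasure μ] {ζ : M} {f : M → M}
    (hf : MeasurePreserving f μ μ) {p : ℕ}
    (hp : 0 < p) {r : ℕ → ℝ} {τ θ : ℝ} (hτ : 0 < τ)
    (hnτ : Tendsto (fun n : ℕ => (n : ℝ) * μ.real (Metric.ball ζ (r n))) atTop (𝓝 τ))
    {Q : ℕ → Set M}
    (hQ : ∀ᶠ n in atTop, Q n = Metric.ball ζ (r n) \ f^[p] ⁻¹' Metric.ball ζ (r n))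
    {T k : ℕ → ℕ} {γ : ℕ → ℕ → ℝ} (hγanti : ∀ n, Antitone (γ n))
    (hγ : Tendsto (fun n : ℕ => (n : ℝ) * γ n (T n)) atTop (𝓝 0))
    (hmix : ∀ n t ℓ : ℕ, |μ.real (Q n ∩ avoid f (Q n) t ℓ)
      - μ.real (Q n) * μ.real (avoid f (Q n) 0 ℓ)| ≤ γ n t)
    (hT : ∀ᶠ n in atTop, 1 ≤ T n)
    (hkT : Tendsto (fun n : ℕ => (k n : ℝ) * T n / n) atTop (𝓝 0)) (hk : Tendsto k atTop atTop)
    (hS : Tendsto (fun n : ℕ => (n : ℝ) * ∑ j ∈ Finset.Icc 1 (n / k n),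
      μ.real (Q n ∩ f^[j] ⁻¹' Q n)) atTop (𝓝 0))
    (hnq : Tendsto (fun n : ℕ => (n : ℝ) * μ.real (Q n)) atTop (𝓝 (τ * θ)))
    {δ : ℕ → ℝ} (hpos : ∀ n, 0 < μ.real (Metric.ball ζ (δ n)))
    (hδ0 : Tendsto (fun n => μ.real (Metric.ball ζ (δ n))) atTop (𝓝 0)) {t : ℝ} (ht : 0 ≤ t) :
    Tendsto (fun n => μ.real (avoid f (Metric.ball ζ (δ n)) 0 ⌊t / μ.real (Metric.ball ζ (δ n))⌋₊))
      atTop (𝓝 (Real.exp (-θ * t))) := by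
  set c : ℕ → ℝ := fun n => μ.real (Metric.ball ζ (δ n)) with hc
  -- The level index is chosen so that `ball ζ (r (m n))`, of measure about `τ / m n`, has
  -- asymptotically the measure `c n` of the given ball.
  set m : ℕ → ℕ := fun n => ⌊τ / c n⌋₊ with hm
  set N : ℕ → ℕ := fun n => ⌊t / c n⌋₊ with hN
  have hbm : ∀ s, MeasurableSet (Metric.ball ζ s) := fun s => Metric.isOpen_ball.measurableSet
  have hmc : Tendsto (fun n => (m n : ℝ) * c n) atTop (𝓝 τ) := tendsto_floor_div_mul hpos hδ0 hτ.le
  have hNc : Tendsto (fun n => (N n : ℝ) * c n) atTop (𝓝 t) := tendsto_floor_div_mul hpos hδ0 ht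
  have hmtop : Tendsto m atTop atTop := by
    have hinv : Tendsto (fun n => (c n)⁻¹) atTop atTop :=
      tendsto_inv_nhdsGT_zero.comp (tendsto_nhdsWithin_iff.2 ⟨hδ0, .of_forall hpos⟩)
    exact tendsto_nat_floor_atTop.comp
      ((hinv.const_mul_atTop hτ).congr fun n => (div_eq_mul_inv _ _).symm)
  have hNm : Tendsto (fun n => (N n : ℝ) / m n) atTop (𝓝 (t / τ)) :=
    (hNc.div hmc hτ.ne').congr fun n => mul_div_mul_right _ _ (hpos n).ne'
  have hQm : ∀ᶠ n in atTop, MeasurableSet (Q n) := by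
    filter_upwards [hQ] with n hn
    rw [hn]
    exact (hbm _).diff ((hf.measurable.iterate p) (hbm _))
  have h1 : Tendsto (fun n => μ.real (avoid f (Q (m n)) 0 (N n))) atTop
      (𝓝 (Real.exp (-(t / τ * (τ * θ))))) :=
    tendsto_measureReal_avoid_exp hf (Q := fun n => Q (m n)) (n := m) (k := fun n => k (m n))
      (T := fun n => T (m n)) (γ := fun n => γ (m n) (T (m n))) (hmtop.eventually hQm)
      (.of_forall fun n s ℓ hs => (hmix (m n) s ℓ).trans (hγanti (m n) hs)) hmtop
      (hk.comp hmtop) (hmtop.eventually hT) (hnq.comp hmtop) (hγ.comp hmtop) (hkT.comp hmtop)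
      (hS.comp hmtop) hNm
  rw [show -(t / τ * (τ * θ)) = -θ * t by field_simp] at h1
  have hB0 : Tendsto (fun n => μ.real (Metric.ball ζ (r (m n)))) atTop (𝓝 0) := by
    have h := (hnτ.mul (tendsto_inv_atTop_zero.comp
      (tendsto_natCast_atTop_atTop (R := ℝ)))).comp hmtop
    rw [mul_zero] at h
    refine h.congr' ?_
    filter_upwards [hmtop.eventually_ge_atTop 1] with n hn
    have hn' : (0 : ℝ) < m n := by exact_mod_cast hn
    simp only [Function.comp_apply]
    field_simp
  have h2 : Tendsto (fun n => μ.real (avoid f (Metric.ball ζ (r (m n))) 0 (N n))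
      - μ.real (avoid f (Q (m n)) 0 (N n))) atTop (𝓝 0) := by
    have hlim : Tendsto (fun n => (p : ℝ) * μ.real (Metric.ball ζ (r (m n)))) atTop (𝓝 0) := by
      simpa using hB0.const_mul (p : ℝ)
    refine squeeze_zero_norm' ?_ hlim
    filter_upwards [hmtop.eventually hQ] with n hn
    rw [hn]
    exact abs_measureReal_avoid_sub_avoid_escape_le hf (hbm _) hp _
  -- Concentric balls are nested, in one order or the other, so the error is `N c |1 - ratio|` with
  -- `N c → t` and ratio tending to `1`.
  have h3 : Tendsto (fun n => μ.real (avoid f (Metric.ball ζ (δ n)) 0 (N n))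
      - μ.real (avoid f (Metric.ball ζ (r (m n))) 0 (N n))) atTop (𝓝 0) := by
    have hratio : Tendsto (fun n => μ.real (Metric.ball ζ (r (m n))) / c n) atTop (𝓝 1) := by
      have h := (hnτ.comp hmtop).div hmc hτ.ne'
      rw [div_self hτ.ne'] at h
      refine h.congr' ?_
      filter_upwards [hmtop.eventually_ge_atTop 1] with n hn
      have hn' : (0 : ℝ) < m n := by exact_mod_cast hn
      exact mul_div_mul_left _ _ hn'.ne'
    have hlim : Tendsto (fun n => (N n : ℝ) * c n *
        |1 - μ.real (Metric.ball ζ (r (m n))) / c n|) atTop (𝓝 0) := by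
      simpa using hNc.mul (hratio.const_sub 1).abs
    refine squeeze_zero_norm' (.of_forall fun n => ?_) hlim
    have hcn : 0 < c n := hpos n
    have heq : (N n : ℝ) * c n * |1 - μ.real (Metric.ball ζ (r (m n))) / c n|
        = N n * |c n - μ.real (Metric.ball ζ (r (m n)))| := by
      rw [mul_assoc, ← abs_of_pos hcn, ← abs_mul, abs_of_pos hcn, mul_sub, mul_one,
        mul_div_cancel₀ _ hcn.ne']
    rw [heq, Real.norm_eq_abs]
    rcases le_total (δ n) (r (m n)) with h | h
    · exact abs_measureReal_avoid_sub_avoid_le hf (hbm _) (hbm _) (Metric.ball_subset_ball h) _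
    · rw [abs_sub_comm, abs_sub_comm (c n)]
      exact abs_measureReal_avoid_sub_avoid_le hf (hbm _) (hbm _) (Metric.ball_subset_ball h) _
  simpa using h3.add (h2.add h1)

/-! ### The extremal index -/

section Statistics

variable {d : ℕ} {H : Type*} [TopologicalSpace H]
  {I : ModelWithCorners ℝ (EuclideanSpace ℝ (Fin d)) H}
  {M : Type*} [MetricSpace M] [SecondCountableTopology M] [ChartedSpace H M] [IsManifold I 1 M]
  [Bundle.RiemannianBundle (fun x : M => TangentSpace I x)]
  [IsContinuousRiemannianBundle (EuclideanSpace ℝ (Fin d)) (fun x : M => TangentSpace I x)]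
  [IsRiemannianManifold I M] [MeasurableSpace M] [BorelSpace M] {Leb : Measure M}
  {μ : Measure M} [IsProbabilityMeasure μ] {ζ : M} {ρ : ℝ}

/-- The extremal index at a repelling fixed point of `f^[p]`: the probability of an escape is
asymptotic to `(1 - |det L⁻¹|) * τ / n`, and the gaps are eventually nonzero. -/
lemma tendsto_nat_mul_measureReal_escape (hLeb : IsVolumeMeasure I Leb) (hμ : μ ≪ Leb)
    (hζ : I.IsInteriorPoint ζ) (hρ : 0 < ρ) (hdens : IsLebesguePoint μ Leb ζ ρ)
    {f : M → M} (hf : MeasurePreserving f μ μ) {p : ℕ} (hp : 0 < p) (hfix : f^[p] ζ = ζ)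
    (hc : ContinuousAt f^[p] ζ)
    (L : EuclideanSpace ℝ (Fin d) ≃L[ℝ] EuclideanSpace ℝ (Fin d))
    (hd : HasFDerivWithinAt (extChartAt I ζ ∘ f^[p] ∘ (extChartAt I ζ).symm)
      (L : EuclideanSpace ℝ (Fin d) →L[ℝ] EuclideanSpace ℝ (Fin d)) (range I)
      (extChartAt I ζ ζ))
    (hdet : |(L.symm : EuclideanSpace ℝ (Fin d) →L[ℝ] EuclideanSpace ℝ (Fin d)).det| < 1)
    (hcontr : ∀ v, Tendsto (fun k : ℕ => L.symm^[k] v) atTop (𝓝 0))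
    {r : ℕ → ℝ} (hr : Tendsto r atTop (𝓝[>] 0)) {τ : ℝ} (hτ : 0 < τ)
    (hnτ : Tendsto (fun n : ℕ => (n : ℝ) * μ.real (Metric.ball ζ (r n))) atTop (𝓝 τ))
    {Q : ℕ → Set M}
    (hQ : ∀ᶠ n in atTop, Q n = Metric.ball ζ (r n) \ f^[p] ⁻¹' Metric.ball ζ (r n))
    {T k : ℕ → ℕ} {γ : ℕ → ℕ → ℝ} (hγ : Tendsto (fun n : ℕ => (n : ℝ) * γ n (T n)) atTop (𝓝 0))
    (hmix : ∀ n t ℓ : ℕ, |μ.real (Q n ∩ avoid f (Q n) t ℓ)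
      - μ.real (Q n) * μ.real (avoid f (Q n) 0 ℓ)| ≤ γ n t)
    (hkT : Tendsto (fun n : ℕ => (k n : ℝ) * T n / n) atTop (𝓝 0)) (hk : Tendsto k atTop atTop)
    (hS : Tendsto (fun n : ℕ => (n : ℝ) * ∑ j ∈ Finset.Icc 1 (n / k n),
      μ.real (Q n ∩ f^[j] ⁻¹' Q n)) atTop (𝓝 0)) :
    (∀ᶠ n in atTop, 1 ≤ T n) ∧ Tendsto (fun n : ℕ => (n : ℝ) * μ.real (Q n)) atTop
      (𝓝 (τ * (1 - |(L.symm : EuclideanSpace ℝ (Fin d) →L[ℝ]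
        EuclideanSpace ℝ (Fin d)).det|))) := by
  obtain ⟨hpos, -⟩ := measureReal_ball_pos_and_tendsto hLeb hμ hζ hρ hdens
  obtain ⟨κ, hκ, hesc, hκeq⟩ := exists_tendsto_escape_div hLeb hμ hζ hρ hdens
    (hf.measurable.iterate p) hfix hc L hd hdet hcontr
  have hr0 : ∀ᶠ n in atTop, 0 < r n := hr.eventually self_mem_nhdsWithin
  -- Positivity of `κ` is enough to obtain nonzero gaps, which in turn serve to identify `κ`.
  have hκ0 : 0 < κ := by linarith
  have hnq : Tendsto (fun n : ℕ => (n : ℝ) * μ.real (Q n)) atTop (𝓝 (τ * κ)) := by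
    refine (hnτ.mul (hesc.comp hr)).congr' ?_
    filter_upwards [hQ, hr0] with n h1 h2
    have h3 := (hpos _ h2).ne'
    simp only [Function.comp_apply, ← h1]
    field_simp
  have hq0 : Tendsto (fun n => μ.real (Q n)) atTop (𝓝 0) := by
    have h := hnq.mul (tendsto_inv_atTop_zero.comp (tendsto_natCast_atTop_atTop (R := ℝ)))
    rw [mul_zero] at h
    refine h.congr' ?_
    filter_upwards [eventually_ge_atTop 1] with n hn
    have hn' : (0 : ℝ) < n := by exact_mod_cast hn
    simp only [Function.comp_apply]
    field_simp
  have hbm : ∀ n, MeasurableSet (Metric.ball ζ (r n)) := fun n => Metric.isOpen_ball.measurableSet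
  have hQm : ∀ᶠ n in atTop, MeasurableSet (Q n) := by
    filter_upwards [hQ] with n hn
    rw [hn]
    exact (hbm n).diff ((hf.measurable.iterate p) (hbm n))
  -- With gap `0` and window length `1`, mixing would bound `n μ(Q) (1 - μ(Q)) → τ κ > 0` by `n γ →
  -- 0`.
  have hT : ∀ᶠ n in atTop, 1 ≤ T n := by
    have h1 : Tendsto (fun n : ℕ => (n : ℝ) * μ.real (Q n) * (1 - μ.real (Q n))) atTop
        (𝓝 (τ * κ)) := by
      simpa using hnq.mul (hq0.const_sub 1)
    have hτκ : 0 < τ * κ := by positivity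
    filter_upwards [h1.eventually_const_lt (half_lt_self hτκ),
      hγ.eventually_lt_const (half_pos hτκ), hQm] with n h2 h3 h4
    by_contra hcon
    have hT0 : T n = 0 := by omega
    have h5 := hmix n (T n) 1
    have h6 : avoid f (Q n) 0 1 = (Q n)ᶜ := by
      ext x
      simp only [avoid, mem_ofPred_eq, mem_compl_iff]
      constructor
      · intro h
        exact h 0 le_rfl (by omega)
      · intro h i _ hi
        obtain rfl : i = 0 := by omega
        exact h
    have h7 : μ.real (Q n) * (1 - μ.real (Q n)) ≤ γ n (T n) := by
      rw [hT0, h6, inter_compl_self, measureReal_empty, probReal_compl_eq_one_sub h4, zero_sub,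
        abs_neg] at h5
      rw [hT0]
      exact (le_abs_self _).trans h5
    have h8 : (n : ℝ) * (μ.real (Q n) * (1 - μ.real (Q n))) ≤ n * γ n (T n) := by gcongr
    rw [← mul_assoc] at h8
    linarith
  refine ⟨hT, ?_⟩
  rw [← hκeq fun j hj => ⟨r, hr, ?_⟩]
  · exact hnq
  -- A second escape after `j` steps of `f^[p]` is the single term with index `p * j` in the sum of
  -- `D'_p`. That index is eventually at most `n / k n`, because `T n ≥ 1` makes `k n = o(n)`.
  have hbound : Tendsto (fun n : ℕ => (n : ℝ) * μ.real (Q n ∩ f^[p * j] ⁻¹' Q n)) atTop (𝓝 0) := by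
    refine squeeze_zero' (.of_forall fun n => by positivity) ?_ hS
    filter_upwards [hT, eventually_ge_atTop 1, hk.eventually_ge_atTop 1,
      hkT.eventually_lt_const (by positivity : (0 : ℝ) < 1 / ((p * j : ℕ) + 1))]
      with n h1 h2 h3 h4
    gcongr
    refine Finset.single_le_sum (f := fun j => μ.real (Q n ∩ f^[j] ⁻¹' Q n))
      (fun _ _ => measureReal_nonneg) (Finset.mem_Icc.2 ⟨Nat.mul_pos hp hj, ?_⟩)
    rw [Nat.le_div_iff_mul_le h3]
    have hn0 : (0 : ℝ) < n := by exact_mod_cast h2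
    have hT1 : (1 : ℝ) ≤ T n := by exact_mod_cast h1
    have hk0 : (0 : ℝ) ≤ k n := Nat.cast_nonneg _
    rw [div_lt_div_iff₀ hn0 (by positivity), one_mul] at h4
    have h5 : ((p * j : ℕ) : ℝ) * k n ≤ n := by
      have h6 : (0 : ℝ) ≤ (p * j : ℕ) := Nat.cast_nonneg _
      nlinarith [mul_nonneg hk0 h6, mul_le_mul_of_nonneg_left hT1 (mul_nonneg hk0 h6)]
    exact_mod_cast h5
  have h := hbound.div hnτ hτ.ne'
  rw [zero_div] at h
  refine h.congr' ?_
  filter_upwards [hQ, eventually_ge_atTop 1] with n h1 h2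
  have hn0 : (n : ℝ) ≠ 0 := by
    have : (0 : ℝ) < n := by exact_mod_cast h2
    exact this.ne'
  rw [← h1, ← Function.iterate_mul]
  exact mul_div_mul_left _ _ hn0

end Statistics

end HittingTimes

end

theorem corollary3p2
    {d : ℕ} {H : Type*} [TopologicalSpace H]
    (I : ModelWithCorners ℝ (EuclideanSpace ℝ (Fin d)) H)
    {M : Type*} [MetricSpace M] [SecondCountableTopology M] [ChartedSpace H M] [IsManifold I 1 M]
    [Bundle.RiemannianBundle (fun x : M => TangentSpace I x)]
    [IsContinuousRiemannianBundle (EuclideanSpace ℝ (Fin d)) (fun x : M => TangentSpace I x)]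
    [IsRiemannianManifold I M]
    [MeasurableSpace M] [BorelSpace M]
    -- the reference measure and the dynamical system
    (Leb : Measure M) (hLeb : HittingTimes.IsVolumeMeasure I Leb)
    (μ : Measure M) [IsProbabilityMeasure μ] (f : M → M) (hf : MeasurePreserving f μ μ)
    (hμ : μ ≪ Leb)
    -- the repelling periodic point, a Lebesgue point of positive finite density
    (p : ℕ) (ζ : M) (hζ : I.IsInteriorPoint ζ)
    (L : TangentSpace I ζ ≃L[ℝ] TangentSpace I ζ)
    (hrep : HittingTimes.IsRepellingPeriodicPoint I f p ζ L)
    (ρ : ℝ) (hρ : 0 < ρ) (hdens : HittingTimes.IsLebesguePoint μ Leb ζ ρ)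
    (θ : ℝ) (hθ : θ = 1 - |(L.symm : TangentSpace I ζ →L[ℝ] TangentSpace I ζ).det|)
    -- the observable, the levels and the mixing conditions
    (g : ℝ → EReal) (hg : HittingTimes.IsPeak g)
    (u : ℕ → ℝ) (τ : ℝ) (hτ : 0 < τ)
    (hu : Tendsto
      (fun n : ℕ => (n : ℝ) * μ.real {x | (u n : EReal) < HittingTimes.process f ζ g 0 x})
      atTop (𝓝 τ))
    (T : ℕ → ℕ)
    (hD : HittingTimes.CondDp μ (HittingTimes.process f ζ g) p u T)
    (hD' : HittingTimes.CondDp' μ (HittingTimes.process f ζ g) p u T)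
    -- the radii
    (δ : ℕ → ℝ) (hδ : ∀ n, 0 < δ n) (hδ0 : Tendsto δ atTop (𝓝 0)) :
    HittingTimes.HasHTS μ f (fun n => Metric.ball ζ (δ n)) (fun t => 1 - Real.exp (-θ * t)) ∧
    HittingTimes.HasRTS μ f (fun n => Metric.ball ζ (δ n))
      (fun t => (1 - θ) + θ * (1 - Real.exp (-θ * t))) ∧
    (∀ t : ℝ, 0 ≤ t → Tendsto
      (fun n => μ.real (HittingTimes.hitLT μ f (Metric.ball ζ (δ n)) t))
      atTop (𝓝 (1 - Real.exp (-θ * t)))) ∧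
    (∀ t : ℝ, 0 < t → Tendsto
      (fun n => (ProbabilityTheory.cond μ (Metric.ball ζ (δ n))).real
        (HittingTimes.hitLT μ f (Metric.ball ζ (δ n)) t))
      atTop (𝓝 ((1 - θ) + θ * (1 - Real.exp (-θ * t))))) := by
  have hdet := hrep.abs_det_lt
  -- In dimension `0` every determinant is `1`, against the strict bound.
  have hd0 : 0 < d := by
    rcases Nat.eq_zero_or_pos d with rfl | h
    · exfalso
      have : (L.symm : TangentSpace I ζ →L[ℝ] TangentSpace I ζ).det = 1 :=
        LinearMap.det_eq_one_of_finrank_eq_zero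
          (finrank_euclideanSpace_fin (𝕜 := ℝ) (n := 0)) _
      rw [this] at hdet
      simp at hdet
    · exact h
  have hfix : f^[p] ζ = ζ := by
    have := Function.isPeriodicPt_minimalPeriod f ζ
    rwa [hrep.minimalPeriod_eq] at this
  let L' : EuclideanSpace ℝ (Fin d) ≃L[ℝ] EuclideanSpace ℝ (Fin d) := L
  have hderiv : HasFDerivWithinAt (extChartAt I ζ ∘ f^[p] ∘ (extChartAt I ζ).symm)
      (L' : EuclideanSpace ℝ (Fin d) →L[ℝ] EuclideanSpace ℝ (Fin d)) (range I)
      (extChartAt I ζ ζ) := by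
    -- The manifold derivative uses the chart at the image point, which is `ζ` again.
    have h : HasFDerivWithinAt (extChartAt I (f^[p] ζ) ∘ f^[p] ∘ (extChartAt I ζ).symm)
      (L' : EuclideanSpace ℝ (Fin d) →L[ℝ] EuclideanSpace ℝ (Fin d)) (range I)
      (extChartAt I ζ ζ) := hrep.hasMFDerivAt.2
    rwa [hfix] at h
  obtain ⟨hpos, hzero⟩ := HittingTimes.measureReal_ball_pos_and_tendsto hLeb hμ hζ hρ hdens
  obtain ⟨r, hr, hVr⟩ := hg.exists_radius hpos hτ hu
  obtain ⟨-, γ, hγanti, hγ, hmix⟩ := hD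
  obtain ⟨k, hk, hkT, hS⟩ := hD'
  simp only [HittingTimes.noEscape_process_eq_avoid] at hmix
  set Q : ℕ → Set M := fun n => HittingTimes.escape (HittingTimes.process f ζ g) p 0 (u n)
  have hQ : ∀ᶠ n in atTop, Q n = Metric.ball ζ (r n) \ f^[p] ⁻¹' Metric.ball ζ (r n) := by
    filter_upwards [hVr] with n hn
    rw [← hn]
    exact HittingTimes.escape_process_zero_eq_diff p (u n)
  have hnτ : Tendsto (fun n : ℕ => (n : ℝ) * μ.real (Metric.ball ζ (r n))) atTop (𝓝 τ) := by
    refine hu.congr' ?_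
    filter_upwards [hVr] with n hn
    rw [hn]
  have hS' : Tendsto (fun n : ℕ => (n : ℝ) * ∑ j ∈ Finset.Icc 1 (n / k n),
      μ.real (Q n ∩ f^[j] ⁻¹' Q n)) atTop (𝓝 0) := by
    refine hS.congr fun n => ?_
    congr 1
    refine Finset.sum_congr rfl fun j _ => ?_
    rw [HittingTimes.escape_process_eq_preimage p j]
  have hkT' := hkT.tendsto_div_nhds_zero
  obtain ⟨hT, hnq⟩ := HittingTimes.tendsto_nat_mul_measureReal_escape hLeb hμ hζ hρ hdens hf
    hrep.period_pos hfix hrep.hasMFDerivAt.1 L' hderiv hdet hrep.contracting hr hτ hnτ hQ hγ hmix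
    hkT' hk hS'
  have hθ' : θ = 1 - |(L'.symm : EuclideanSpace ℝ (Fin d) →L[ℝ]
    EuclideanSpace ℝ (Fin d)).det| := hθ
  rw [← hθ'] at hnq
  have hδpos : ∀ n, 0 < μ.real (Metric.ball ζ (δ n)) := fun n => hpos _ (hδ n)
  have hδ0' : Tendsto (fun n => μ.real (Metric.ball ζ (δ n))) atTop (𝓝 0) :=
    (hzero hd0).comp (tendsto_nhdsWithin_iff.2 ⟨hδ0, .of_forall hδ⟩)
  exact HittingTimes.hasHTS_and_hasRTS_of_tendsto_avoid hf
    (fun n => Metric.isOpen_ball.measurableSet) hδpos hδ0' fun t ht =>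
      HittingTimes.tendsto_measureReal_avoid_ball hf hrep.period_pos hτ hnτ hQ hγanti hγ hmix hT
        hkT' hk hS' hnq hδpos hδ0' ht
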